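/- Let $n \ge 1$ agents and $m \ge 2n$ indivisible items be given. Agent $i$ has a private valuation $v_i$, which assigns a non-negative real value to every set of items; it is additive if $v_i(S)=\sum_{e\in S} v_i(\{e\})$ for all $S$. An allocation is a partition of the items into $n$ (possibly empty) bundles $A_1,\dots,A_n$, with $A_i$ given to agent $i$. It is EF1 if for all $i\neq j$ either $v_i(A_i)\ge v_i(A_j)$ or $v_i(A_i)\ge v_i(A_j\setminus\{e\})$ for some $e\in A_j$. In a deterministic protocol, agents are adaptively asked arbitrary queries about their own valuations, and the list of replies determines an allocation; the (deterministic) communication complexity of EF1 for a class of instances is the least, over all protocols that produce an EF1 allocation on every instance of the class, of the worst-case total number of bits sent in reply. The description complexity is the same quantity when all queries are directed to one special agent who knows all the valuations. Then, with absolute constants in the $O$-notation: 1. For additive valuations, the communication complexity of EF1 allocations is $O(m\log m)$. 2. For additive valuations, the description complexity of EF1 allocations is $O(n\log m)$. 3. For instances in which all agents have the same valuation, the communication complexity of EF1 allocations is $O(n\log\frac{m}{n})$. This holds for every class of monotone valuations (those with $v(S)\le v(T)$ whenever $S\subseteq T$), in particular for additive and for unit demand valuations ($v(S)=\max_{e\in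 S}v(\{e\})$). -/

import Mathlib

namespace FairAllocation

/-- A deterministic protocol: a decision tree whose inner nodes query an agent. The agent `i`
who is queried transmits one bit, an arbitrary function `q` of her own private input, and the
protocol continues according to that bit. A leaf declares the output. (A reply of `k` bits is
given as `k` consecutive one-bit replies of the same agent.) -/
inductive Protocol (Agent Input Output : Type) : Type where
  | output (o : Output) : Protocol Agent Input Output
  | query (i : Agent) (q : Input → Bool) (next : Bool → Protocol Agent Input Output) :
      Protocol Agent Input Output

namespace Protocol

variable {Agent Input Output : Type}

/-- The list of bits transmitted by the agents when `x i` is the private input of agent `i`. -/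
def transcript : Protocol Agent Input Output → (Agent → Input) → List Bool
  | .output _, _ => []
  | .query i q next, x => q (x i) :: (next (q (x i))).transcript x

/-- The output of the protocol when `x i` is the private input of agent `i`. -/
def result : Protocol Agent Input Output → (Agent → Input) → Output
  | .output o, _ => o
  | .query i q next, x => (next (q (x i))).result x

end Protocol

/-- The deterministic communication complexity of finding an acceptable output on the inputs from
`I`: the least, over all protocols that are correct on every input from `I`, of the
worst-case number of transmitted bits over `I`. It is `⊤` if there is no such protocol of bounded
transcript length. -/
noncomputable def communicationComplexity {Agent Input Output : Type}
    (I : Set (Agent → Input)) (Acceptable : (Agent → Input) → Output → Prop) : ℕ∞ :=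
  ⨅ (P : Protocol Agent Input Output) (_ : ∀ x ∈ I, Acceptable x (P.result x)),
    ⨆ x ∈ I, ((P.transcript x).length : ℕ∞)

/-- The deterministic description complexity: the communication complexity when all queries are
directed to a single special agent, whose private input is the whole instance. -/
noncomputable def descriptionComplexity {Agent Input Output : Type}
    (I : Set (Agent → Input)) (Acceptable : (Agent → Input) → Output → Prop) : ℕ∞ :=
  communicationComplexity (Agent := Unit) (Input := Agent → Input)
    {y | y () ∈ I} (fun y o => Acceptable (y ()) o)

/-- A function assigning a real value to every set of items, the items being `Fin m`. -/
abbrev Valuation (m : ℕ) : Type := Finset (Fin m) → ℝ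

/-- An allocation of `m` items to `n` agents: every item is given to exactly one agent. -/
abbrev Allocation (n m : ℕ) : Type := Fin m → Fin n

/-- The bundle of items that agent `i` receives. -/
def Allocation.bundle {n m : ℕ} (A : Allocation n m) (i : Fin n) : Finset (Fin m) :=
  Finset.univ.filter (fun e => A e = i)

/-- Envy-freeness up to one item. -/
def IsEF1 {n m : ℕ} (v : Fin n → Valuation m) (A : Allocation n m) : Prop :=
  ∀ i j : Fin n, i ≠ j →
    v i (A.bundle j) ≤ v i (A.bundle i) ∨
      ∃ e ∈ A.bundle j, v i (A.bundle j \ {e}) ≤ v i (A.bundle i)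

/-- The additive valuations with non-negative item values. -/
def additiveValuations (m : ℕ) : Set (Valuation m) :=
  {v | ∃ w : Fin m → ℝ, (∀ e, 0 ≤ w e) ∧ ∀ S, v S = ∑ e ∈ S, w e}

/-- The non-negative monotone valuations; they include the additive and the unit demand ones. -/
def monotoneValuations (m : ℕ) : Set (Valuation m) :=
  {v | (∀ S, 0 ≤ v S) ∧ Monotone v}

/-- The instances with `n` agents, each having a valuation from the class `C`. -/
def instances (n : ℕ) {m : ℕ} (C : Set (Valuation m)) : Set (Fin n → Valuation m) :=
  {v | ∀ i, v i ∈ C}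

/-- The instances with `n` agents who all have the same valuation, which belongs to `C`. -/
def identicalInstances (n : ℕ) {m : ℕ} (C : Set (Valuation m)) : Set (Fin n → Valuation m) :=
  {v | ∃ u ∈ C, ∀ i, v i = u}

end FairAllocation

open FairAllocation

/-! Part 1 is the round robin protocol: `m` picks of about `log m` bits each. It is EF1 because the
envied agent's picks, without her first one if she precedes the envious agent, can be matched with
earlier picks of the envious agent (`IsGreedy.isEF1`).

Parts 2 and 3 rest on the fact that, for monotone valuations, a small family of allocations always
contains one that is EF1 up to a permutation of the agents (`exists_code_isEF1`); one informed agent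
names it. Put the items on a line, each of length 2, and cut the line at integer points into `n`
intervals; an interval contains the items that lie wholly inside it. The divisions are the lattice
points of a simplex with its Kuhn triangulation. Label the vertex at position `i` of each small
simplex with agent `i`'s favourite interval. An interval of length 0 need never be the favourite, so
Sperner's lemma (`exists_bijective_label`) yields `n` divisions, with corresponding cuts at most 1
apart, in which the agents have different favourites.

Each agent receives her favourite interval from her own division. Items are longer than the
displacement of the cuts, so these bundles are disjoint, and each exceeds the corresponding interval
of any other division by at most one item. At most `n - 1` items are cut somewhere, and a count
(`exists_card_eq_leftover`) shows that the unassigned ones can go, one each, to bundles that exceed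
no corresponding interval.

A code is one division, a shift in {-1, 0, 1} for each end of each interval, and the set of
recipients of leftovers. As `m ≥ 2 * n`, there are at most `(m / n) ^ (9 * n)` codes. The
permutation costs a further factor `n! ≤ m ^ n`, which identical agents do not need. -/

namespace FairAllocation

/-! ### Sending a number bit by bit -/

namespace Protocol

variable {Agent Input Output : Type}

/-- Agent `i` transmits the `b` lowest bits of the number `f x`, and the protocol continues with
`k`, applied to the number transmitted. -/
def ask (i : Agent) : ℕ → (Input → ℕ) → (ℕ → Protocol Agent Input Output) →
    Protocol Agent Input Output
  | 0, _, k => k 0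
  | b + 1, f, k => .query i (fun x => (f x).bodd) fun c =>
      ask i b (fun x => (f x).div2) (fun r => k (Nat.bit c r))

theorem result_ask (i : Agent) (x : Agent → Input) (b : ℕ) (f : Input → ℕ)
    (k : ℕ → Protocol Agent Input Output) (h : f (x i) < 2 ^ b) :
    (ask i b f k).result x = (k (f (x i))).result x := by
  induction b generalizing f k with
  | zero =>
    have h0 : f (x i) = 0 := by simpa using h
    simp [ask, h0]
  | succ b ih =>
    have h2 : (f (x i)).div2 < 2 ^ b := by
      rw [Nat.div2_val]
      rw [pow_succ] at h
      omega
    simp only [ask, result]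
    rw [ih _ _ h2, Nat.bit_bodd_div2]

theorem length_transcript_ask (i : Agent) (x : Agent → Input) (b : ℕ) (f : Input → ℕ)
    (k : ℕ → Protocol Agent Input Output) (h : f (x i) < 2 ^ b) :
    ((ask i b f k).transcript x).length = b + ((k (f (x i))).transcript x).length := by
  induction b generalizing f k with
  | zero =>
    have h0 : f (x i) = 0 := by simpa using h
    simp [ask, h0]
  | succ b ih =>
    have h2 : (f (x i)).div2 < 2 ^ b := by
      rw [Nat.div2_val]
      rw [pow_succ] at h
      omega
    simp only [ask, transcript, List.length_cons]
    rw [ih _ _ h2, Nat.bit_bodd_div2]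
    omega

end Protocol

/-! ### Upper bounds on complexity from explicit protocols -/

section Bounds

variable {Agent Input Output : Type} {I : Set (Agent → Input)}
  {Acceptable : (Agent → Input) → Output → Prop}

theorem communicationComplexity_le (P : Protocol Agent Input Output) (b : ℕ)
    (h : ∀ x ∈ I, Acceptable x (P.result x)) (hb : ∀ x ∈ I, (P.transcript x).length ≤ b) :
    communicationComplexity I Acceptable ≤ b :=
  iInf₂_le_of_le P h (iSup₂_le fun x hx => by exact_mod_cast hb x hx)

/-- If one agent can name an acceptable member of a finite family of outputs, then her naming it
is a protocol. -/
theorem communicationComplexity_le_of_family {K : Type} [Fintype K] (i : Agent) (o : Output)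
    (decode : K → Output) (choice : Input → K) (b : ℕ) (hK : Fintype.card K ≤ 2 ^ b)
    (h : ∀ x ∈ I, Acceptable x (decode (choice (x i)))) :
    communicationComplexity I Acceptable ≤ b := by
  classical
  set e := Fintype.equivFin K
  have hlt : ∀ u, (e (choice u) : ℕ) < 2 ^ b := fun u => (e (choice u)).2.trans_le hK
  refine communicationComplexity_le
    (Protocol.ask i b (fun u => e (choice u)) fun r =>
      .output (if hr : r < Fintype.card K then decode (e.symm ⟨r, hr⟩) else o)) b ?_ ?_
  · intro x hx
    rw [Protocol.result_ask i x b (fun u => (e (choice u) : ℕ)) _ (hlt _)]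
    simpa [Protocol.result] using h x hx
  · intro x _
    rw [Protocol.length_transcript_ask i x b (fun u => (e (choice u) : ℕ)) _ (hlt _)]
    simp [Protocol.transcript]

theorem toENNReal_le_ofReal {a : ℕ∞} {b : ℕ} {r : ℝ} (h : a ≤ b) (hb : (b : ℝ) ≤ r) :
    (a : ENNReal) ≤ ENNReal.ofReal r := by
  calc (a : ENNReal) ≤ ((b : ℕ∞) : ENNReal) := by exact_mod_cast h
    _ = ENNReal.ofReal b := by simp
    _ ≤ ENNReal.ofReal r := ENNReal.ofReal_le_ofReal hb

end Bounds

/-! ### Round robin for additive valuations -/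

section RoundRobin

variable {n m : ℕ}

open Classical in
/-- The number of an item outside `L` that is most valuable on its own. -/
noncomputable def favouriteIndex (L : List (Fin m)) (u : Valuation m) : ℕ :=
  if h : ∃ e : Fin m, e ∉ L ∧ ∀ e' ∉ L, u {e'} ≤ u {e} then h.choose.val else 0

theorem exists_favourite {L : List (Fin m)} (hL : L.length < m) (u : Valuation m) :
    ∃ e : Fin m, e ∉ L ∧ (∀ e' ∉ L, u {e'} ≤ u {e}) ∧ favouriteIndex L u = e.val := by
  classical
  have hne : (Finset.univ \ L.toFinset).Nonempty := by
    rw [← Finset.card_pos]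
    have h1 := Finset.le_card_sdiff L.toFinset (Finset.univ : Finset (Fin m))
    have h2 := L.toFinset_card_le
    rw [Finset.card_univ, Fintype.card_fin] at h1
    omega
  obtain ⟨e, he, hmax⟩ := Finset.exists_max_image _ (fun e => u {e}) hne
  have h : ∃ e : Fin m, e ∉ L ∧ ∀ e' ∉ L, u {e'} ≤ u {e} :=
    ⟨e, by simpa using he, fun e' he' => hmax e' (by simpa using he')⟩
  refine ⟨h.choose, h.choose_spec.1, h.choose_spec.2, ?_⟩
  rw [favouriteIndex, dif_pos h]

/-- The agents take turns, and the item picked in round `t` goes to agent `t % n`. -/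
def turnAllocation (hn : 0 < n) (L : List (Fin m)) : Allocation n m :=
  fun e => ⟨L.idxOf e % n, Nat.mod_lt _ hn⟩

/-- `k` more rounds of the round robin protocol, after the items in `L` have been picked. -/
noncomputable def roundRobin (hn : 0 < n) : ℕ → List (Fin m) →
    Protocol (Fin n) (Valuation m) (Allocation n m)
  | 0, L => .output (turnAllocation hn L)
  | k + 1, L => .ask ⟨L.length % n, Nat.mod_lt _ hn⟩ (Nat.clog 2 m) (favouriteIndex L)
      -- The bits could encode a number from `m` on, but by `exists_favourite` the actual reply does
      -- not while items remain; the fallback `L` only makes the definition total.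
      fun r => roundRobin hn k (if h : r < m then L ++ [⟨r, h⟩] else L)

/-- In every round of `L`, the item picked is the favourite remaining item of the agent. -/
def IsGreedy (hn : 0 < n) (v : Fin n → Valuation m) (L : List (Fin m)) : Prop :=
  L.Nodup ∧ ∀ (s : ℕ) (hs : s < L.length), ∀ e ∉ L.take s,
    v ⟨s % n, Nat.mod_lt _ hn⟩ {e} ≤ v ⟨s % n, Nat.mod_lt _ hn⟩ {L[s]}

theorem IsGreedy.append {hn : 0 < n} {v : Fin n → Valuation m} {L : List (Fin m)}
    (hL : IsGreedy hn v L) {e : Fin m} (he : e ∉ L)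
    (hmax : ∀ e' ∉ L, v ⟨L.length % n, Nat.mod_lt _ hn⟩ {e'} ≤
      v ⟨L.length % n, Nat.mod_lt _ hn⟩ {e}) : IsGreedy hn v (L ++ [e]) := by
  refine ⟨List.nodup_append.2 ⟨hL.1, by simp, ?_⟩, ?_⟩
  · rintro a ha b hb rfl
    simp at hb
    exact he (hb ▸ ha)
  · intro s hs e' he'
    rw [List.length_append, List.length_singleton] at hs
    rcases Nat.lt_succ_iff_lt_or_eq.1 hs with h | rfl
    · rw [List.getElem_append_left h]
      refine hL.2 s h e' fun hmem => he' ?_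
      rw [List.take_append_of_le_length h.le]
      exact hmem
    · simp only [List.getElem_concat_length]
      refine hmax e' fun hmem => he' ?_
      simpa using hmem

theorem roundRobin_spec (hn : 0 < n) (v : Fin n → Valuation m) (k : ℕ) (L : List (Fin m))
    (hL : IsGreedy hn v L) (hk : L.length + k = m) :
    ∃ L' : List (Fin m), IsGreedy hn v L' ∧ L'.length = m ∧
      (roundRobin hn k L).result v = turnAllocation hn L' ∧
      ((roundRobin hn k L).transcript v).length = k * Nat.clog 2 m := by
  induction k generalizing L with
  | zero => exact ⟨L, hL, hk, rfl, by simp [roundRobin, Protocol.transcript]⟩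
  | succ k ih =>
    obtain ⟨e, he, hmax, hval⟩ := exists_favourite (L := L) (by omega)
      (v ⟨L.length % n, Nat.mod_lt _ hn⟩)
    have hlt : favouriteIndex L (v ⟨L.length % n, Nat.mod_lt _ hn⟩) < 2 ^ Nat.clog 2 m := by
      rw [hval]
      exact e.2.trans_le (Nat.le_pow_clog (by norm_num) m)
    obtain ⟨L', h1, h2, h3, h4⟩ := ih (L ++ [e]) (hL.append he hmax) (by simp; omega)
    refine ⟨L', h1, h2, ?_, ?_⟩
    · rw [roundRobin, Protocol.result_ask _ _ _ _ _ hlt, hval, dif_pos e.2]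
      exact h3
    · rw [roundRobin, Protocol.length_transcript_ask _ _ _ _ _ hlt, hval, dif_pos e.2, h4]
      ring

theorem IsGreedy.isEF1 {hn : 0 < n} {v : Fin n → Valuation m} {L : List (Fin m)}
    (hL : IsGreedy hn v L) (hlen : L.length = m) (hnm : n ≤ m)
    (hv : v ∈ instances n (additiveValuations m)) : IsEF1 v (turnAllocation hn L) := by
  classical
  have hmem : ∀ e, e ∈ L := by
    have h := L.toFinset_card_of_nodup hL.1
    have h2 : L.toFinset = Finset.univ := by
      rw [← Finset.card_eq_iff_eq_univ, h, hlen, Fintype.card_fin]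
    intro e
    have := Finset.mem_univ e
    rw [← h2] at this
    simpa using this
  have hidx : ∀ e, L.idxOf e < m := fun e =>
    (List.idxOf_lt_length_of_mem (hmem e)).trans_eq hlen
  have hbundle : ∀ (i : Fin n) e,
      e ∈ (turnAllocation hn L).bundle i ↔ L.idxOf e % n = i := by
    intro i e
    simp [Allocation.bundle, turnAllocation, Fin.ext_iff]
  -- A bundle is no better than the bundle of `i` if its items are picked, one to one, after
  -- the items of `i`.
  have key : ∀ (i : Fin n) (S : Finset (Fin m)) (f : ℕ → ℕ),
      (∀ e ∈ S, f (L.idxOf e) ≤ L.idxOf e) → (∀ e ∈ S, f (L.idxOf e) % n = i) →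
      (∀ e ∈ S, ∀ e' ∈ S, f (L.idxOf e) = f (L.idxOf e') → L.idxOf e = L.idxOf e') →
      v i S ≤ v i ((turnAllocation hn L).bundle i) := by
    intro i S f h1 h2 h3
    obtain ⟨w, hw, hadd⟩ := hv i
    rw [hadd, hadd]
    have hb : ∀ e ∈ S, f (L.idxOf e) < L.length := fun e he => by
      rw [hlen]; exact (h1 e he).trans_lt (hidx e)
    let g : Fin m → Fin m := fun e => if h : f (L.idxOf e) < L.length then L[f (L.idxOf e)] else e
    have hg : ∀ e ∈ S, ∃ h : f (L.idxOf e) < L.length, g e = L[f (L.idxOf e)] := fun e he =>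
      ⟨hb e he, by simp only [g]; rw [dif_pos (hb e he)]⟩
    have hgi : ∀ e ∈ S, L.idxOf (g e) = f (L.idxOf e) := fun e he => by
      obtain ⟨h, hge⟩ := hg e he
      rw [hge]
      exact hL.1.idxOf_getElem _ _
    have hle : ∀ e ∈ S, w e ≤ w (g e) := by
      intro e he
      obtain ⟨h, hge⟩ := hg e he
      have h4 := hL.2 _ h e (by
        intro hm
        have h5 := List.idxOf_lt_length_of_mem hm
        have h6 : (L.take (f (L.idxOf e))).idxOf e = L.idxOf e := by
          conv_rhs => rw [← List.take_append_drop (f (L.idxOf e)) L]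
          rw [List.idxOf_append_of_mem hm]
        rw [h6, List.length_take] at h5
        have := h1 e he
        omega)
      have h7 : (⟨f (L.idxOf e) % n, Nat.mod_lt _ hn⟩ : Fin n) = i := Fin.ext (h2 e he)
      rw [h7, hadd, hadd, Finset.sum_singleton, Finset.sum_singleton] at h4
      rwa [hge]
    have hinj : Set.InjOn g S := by
      intro e he e' he' hee
      have h8 := h3 e he e' he' (by rw [← hgi e he, ← hgi e' he', hee])
      exact (List.idxOf_inj (hmem e)).1 h8
    calc ∑ e ∈ S, w e ≤ ∑ e ∈ S, w (g e) := Finset.sum_le_sum hle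
      _ = ∑ e ∈ S.image g, w e := (Finset.sum_image hinj).symm
      _ ≤ _ := by
        refine Finset.sum_le_sum_of_subset_of_nonneg ?_ fun e _ _ => hw e
        intro e he
        obtain ⟨e', he', rfl⟩ := Finset.mem_image.1 he
        rw [hbundle, hgi e' he', h2 e' he']
  intro i j hij
  have hmod : ∀ t : ℕ, t % n = j → ∃ a, t = j + n * a := fun t ht =>
    ⟨t / n, by rw [← ht]; exact (Nat.mod_add_div t n).symm⟩
  rcases lt_or_gt_of_ne hij with h | h
  · left
    have h' : (i : ℕ) < j := h
    -- In every round agent `i` picks `j - i` turns before agent `j`.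
    refine key i _ (fun t => t - (j - i)) (fun e _ => Nat.sub_le _ _) ?_ ?_
    · intro e he
      obtain ⟨a, ha⟩ := hmod _ ((hbundle _ _).1 he)
      have : L.idxOf e - (j - i) = i + n * a := by omega
      simp only [this, Nat.add_mul_mod_self_left]
      exact Nat.mod_eq_of_lt i.2
    · intro e he e' he' hee
      obtain ⟨a, ha⟩ := hmod _ ((hbundle _ _).1 he)
      obtain ⟨a', ha'⟩ := hmod _ ((hbundle _ _).1 he')
      omega
  · right
    have h' : (j : ℕ) < i := h
    have hj : (j : ℕ) < L.length := by have := j.2; omega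
    have hfirst : L.idxOf L[(j : ℕ)] = j := hL.1.idxOf_getElem _ _
    refine ⟨L[(j : ℕ)], ?_, ?_⟩
    · rw [hbundle, hfirst, Nat.mod_eq_of_lt j.2]
    · have hS : ∀ e ∈ (turnAllocation hn L).bundle j \ {L[(j : ℕ)]},
          ∃ a, L.idxOf e = j + n + n * a := by
        intro e he
        rw [Finset.mem_sdiff, Finset.mem_singleton] at he
        obtain ⟨a, ha⟩ := hmod _ ((hbundle _ _).1 he.1)
        cases a with
        | zero =>
          exfalso
          apply he.2
          apply (List.idxOf_inj (hmem e)).1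
          rw [ha, hfirst]
          simp
        | succ a => exact ⟨a, by rw [ha]; ring⟩
      have hi := i.2
      -- Each later pick of `j` is preceded, by `n + j - i` turns, by the pick of `i` in the
      -- previous round.
      refine key i _ (fun t => t - (n + j - i)) (fun e _ => Nat.sub_le _ _) ?_ ?_
      · intro e he
        obtain ⟨a, ha⟩ := hS e he
        have : L.idxOf e - (n + j - i) = i + n * a := by omega
        simp only [this, Nat.add_mul_mod_self_left]
        exact Nat.mod_eq_of_lt i.2
      · intro e he e' he' hee
        obtain ⟨a, ha⟩ := hS e he
        obtain ⟨a', ha'⟩ := hS e' he'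
        omega

theorem communicationComplexity_additive_le (hn : 0 < n) (hnm : n ≤ m) :
    communicationComplexity (instances n (additiveValuations m)) IsEF1 ≤
      (m * Nat.clog 2 m : ℕ) := by
  have h0 : ∀ v : Fin n → Valuation m, IsGreedy hn v [] := fun v => ⟨by simp, by simp⟩
  refine communicationComplexity_le (roundRobin hn m []) _ ?_ ?_
  · intro v hv
    obtain ⟨L, h1, h2, h3, -⟩ := roundRobin_spec hn v m [] (h0 v) (by simp)
    rw [h3]
    exact h1.isEF1 h2 hnm hv
  · intro v _
    obtain ⟨L, -, -, -, h4⟩ := roundRobin_spec hn v m [] (h0 v) (by simp)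
    exact h4.le

end RoundRobin

/-! ### Sperner's lemma on the Kuhn triangulation -/

section Sperner

variable {N : ℕ}

theorem Fin.add_one_ne (i : Fin (N + 2)) : i + 1 ≠ i := by
  intro h
  have : (1 : Fin (N + 2)) = 0 := by simp at h
  exact one_ne_zero this

theorem Fin.sub_one_ne (i : Fin (N + 2)) : i - 1 ≠ i := by
  intro h
  exact Fin.add_one_ne i (by rw [sub_eq_iff_eq_add] at h; exact h.symm)

theorem Fin.ofNat_succ_eq (t : ℕ) : Fin.ofNat (N + 2) (t + 1) = Fin.ofNat (N + 2) t + 1 := by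
  apply Fin.ext
  simp [Fin.val_add]

theorem Fin.exists_add_ofNat (i j : Fin (N + 2)) : ∃ t < N + 2, j = i + Fin.ofNat (N + 2) t :=
  ⟨(j - i).val, (j - i).2, by simp⟩

theorem Fin.eq_of_forall_add_one {α : Type*} {h : Fin (N + 2) → α} (hh : ∀ j, h (j + 1) = h j)
    (i j : Fin (N + 2)) : h j = h i := by
  obtain ⟨t, -, rfl⟩ := Fin.exists_add_ofNat i j
  induction t with
  | zero => simp
  | succ t ih => rw [Fin.ofNat_succ_eq, ← add_assoc, hh, ih]

/-- The elementary move that transfers a unit from coordinate `a + 1` to coordinate `a`. -/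
def transfer (a : Fin (N + 2)) : Fin (N + 2) → ℤ := Pi.single a 1 - Pi.single (a + 1) 1

theorem transfer_apply (a k : Fin (N + 2)) :
    transfer a k = (if a = k then 1 else 0) - (if a + 1 = k then 1 else 0) := by
  simp [transfer, Pi.single_apply, eq_comm]

theorem transfer_injective : Function.Injective (transfer (N := N)) := by
  intro a b h
  have h1 := congrFun h a
  rw [transfer_apply, transfer_apply, if_pos rfl, if_neg (Fin.add_one_ne a)] at h1
  by_contra hne
  rw [if_neg (Ne.symm hne)] at h1
  split_ifs at h1 <;> omega

theorem sum_transfer (a : Fin (N + 2)) : ∑ k, transfer a k = 0 := by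
  simp [transfer_apply, Finset.sum_sub_distrib]

/-- The sum of all coordinates, each one weighted by its own index modulo the dimension. -/
def weight (y : Fin (N + 2) → ℤ) : Fin (N + 2) := ∑ k, y k • k

theorem weight_add (y y' : Fin (N + 2) → ℤ) : weight (y + y') = weight y + weight y' := by
  simp [weight, add_smul, Finset.sum_add_distrib]

theorem weight_single (a : Fin (N + 2)) (r : ℤ) : weight (Pi.single a r) = r • a := by
  rw [weight, Finset.sum_eq_single a]
  · simp
  · intro b _ hb
    simp [hb]
  · simp

/-- A unit moves from index `a + 1` to index `a`. Hence the weight falls by one along each edge of a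
Kuhn cycle and records the position of a vertex. -/
theorem weight_transfer (a : Fin (N + 2)) : weight (transfer a) = -1 := by
  have h : transfer a + Pi.single (a + 1) 1 = Pi.single a 1 := by simp [transfer]
  have h2 := congrArg weight h
  rw [weight_add, weight_single, weight_single, one_smul, one_smul] at h2
  have h3 := eq_sub_of_add_eq h2
  rw [h3]
  abel

/-- The cyclic sequence of points `z` runs through the vertices of a simplex of the Kuhn
triangulation; the moves between consecutive vertices are in the order `τ`. -/
def IsKuhnCycle (z : Fin (N + 2) → Fin (N + 2) → ℤ) (τ : Equiv.Perm (Fin (N + 2))) : Prop :=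
  ∀ i, z (i + 1) = z i + transfer (τ i)

/-- Fewer than `N + 2` steps lead from `z i` to `z j`, so each move occurs at most once: `φ` rises
at most once, by move `b`, and falls at most once, by move `c`. -/
theorem IsKuhnCycle.abs_sub_le {z : Fin (N + 2) → Fin (N + 2) → ℤ}
    {τ : Equiv.Perm (Fin (N + 2))} (h : IsKuhnCycle z τ) (φ : (Fin (N + 2) → ℤ) →+ ℤ)
    (b c : Fin (N + 2))
    (hφ : ∀ a, φ (transfer a) = (if a = b then 1 else 0) - (if a = c then 1 else 0))
    (i j : Fin (N + 2)) : |φ (z j) - φ (z i)| ≤ 1 := by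
  obtain ⟨t, ht, rfl⟩ := Fin.exists_add_ofNat i j
  have hpath : ∀ t : ℕ, φ (z (i + Fin.ofNat (N + 2) t)) - φ (z i) =
      ∑ s ∈ Finset.range t, (if τ (i + Fin.ofNat (N + 2) s) = b then 1 else 0) -
      ∑ s ∈ Finset.range t, (if τ (i + Fin.ofNat (N + 2) s) = c then 1 else 0) := by
    intro t
    induction t with
    | zero => simp
    | succ t ih =>
      rw [Finset.sum_range_succ, Finset.sum_range_succ, Fin.ofNat_succ_eq, ← add_assoc, h,
        map_add, hφ]
      linarith
  have hbound : ∀ b, (0 : ℤ) ≤ ∑ s ∈ Finset.range t,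
        (if τ (i + Fin.ofNat (N + 2) s) = b then 1 else 0) ∧
      ∑ s ∈ Finset.range t, (if τ (i + Fin.ofNat (N + 2) s) = b then (1 : ℤ) else 0) ≤ 1 := by
    intro b
    refine ⟨Finset.sum_nonneg fun s _ => by split_ifs <;> simp, ?_⟩
    rw [← Finset.sum_filter, Finset.sum_const, nsmul_one]
    norm_cast
    rw [Finset.card_le_one]
    intro s hs s' hs'
    rw [Finset.mem_filter, Finset.mem_range] at hs hs'
    have := τ.injective (hs.2.trans hs'.2.symm)
    have := congrArg Fin.val (add_left_cancel this)
    simp only [Fin.val_ofNat] at this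
    rwa [Nat.mod_eq_of_lt (by omega), Nat.mod_eq_of_lt (by omega)] at this
  rw [hpath, abs_le]
  have hb := hbound b
  have hc := hbound c
  constructor <;> linarith [hb.1, hb.2, hc.1, hc.2]

theorem IsKuhnCycle.abs_coord_sub_le {z : Fin (N + 2) → Fin (N + 2) → ℤ}
    {τ : Equiv.Perm (Fin (N + 2))} (h : IsKuhnCycle z τ) (k i j : Fin (N + 2)) :
    |z j k - z i k| ≤ 1 := by
  refine h.abs_sub_le (Pi.evalAddMonoidHom _ k) k (k - 1) (fun a => ?_) i j
  simp [transfer_apply, eq_sub_iff_add_eq]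

/-- A simplex of the Kuhn triangulation of the points with coordinates at least `-1` and sum `M`.
The condition on the weights makes the index of a vertex a function of the vertex. -/
structure IsRoom (M : ℕ) (z : Fin (N + 2) → Fin (N + 2) → ℤ) (τ : Equiv.Perm (Fin (N + 2))) :
    Prop where
  cycle : IsKuhnCycle z τ
  neg_one_le : ∀ i k, -1 ≤ z i k
  sum_eq : ∀ i, ∑ k, z i k = M
  weight_eq : ∀ i, i + weight (z i) = 0

variable {M : ℕ} {z : Fin (N + 2) → Fin (N + 2) → ℤ} {τ : Equiv.Perm (Fin (N + 2))}

/-- The other vertex that can complete the vertices of `z` except `z i` to a simplex. -/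
def flipVertex (z : Fin (N + 2) → Fin (N + 2) → ℤ) (τ : Equiv.Perm (Fin (N + 2)))
    (i : Fin (N + 2)) : Fin (N + 2) → ℤ := z (i - 1) + transfer (τ i)

/-- The simplex that shares with `z` all vertices except `z i`, and the order of its moves. -/
def flip (x : (Fin (N + 2) → Fin (N + 2) → ℤ) × Equiv.Perm (Fin (N + 2)) × Fin (N + 2)) :
    (Fin (N + 2) → Fin (N + 2) → ℤ) × Equiv.Perm (Fin (N + 2)) × Fin (N + 2) :=
  (Function.update x.1 x.2.2 (flipVertex x.1 x.2.1 x.2.2),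
    x.2.1 * Equiv.swap (x.2.2 - 1) x.2.2, x.2.2)

theorem IsKuhnCycle.eq_sub_one (h : IsKuhnCycle z τ) (i : Fin (N + 2)) :
    z i = z (i - 1) + transfer (τ (i - 1)) := by
  have := h (i - 1)
  rwa [sub_add_cancel] at this

/-- Replacing `z i` amounts to exchanging the two moves next to it, and a second exchange undoes the
first. -/
theorem flip_flip (h : IsKuhnCycle z τ) (i : Fin (N + 2)) : flip (flip (z, τ, i)) = (z, τ, i) := by
  have h1 : flipVertex (Function.update z i (flipVertex z τ i)) (τ * Equiv.swap (i - 1) i) i =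
      z i := by
    rw [flipVertex, Function.update_of_ne (Fin.sub_one_ne i), Equiv.Perm.mul_apply,
      Equiv.swap_apply_right]
    exact (h.eq_sub_one i).symm
  simp only [flip, h1, Function.update_idem, Function.update_eq_self, mul_assoc,
    Equiv.swap_mul_self, mul_one]

theorem flip_ne (z : Fin (N + 2) → Fin (N + 2) → ℤ) (τ : Equiv.Perm (Fin (N + 2)))
    (i : Fin (N + 2)) : flip (z, τ, i) ≠ (z, τ, i) := by
  intro h
  have h2 : τ * Equiv.swap (i - 1) i = τ := congrArg (fun x => x.2.1) h
  rw [mul_eq_left, Equiv.swap_eq_one_iff] at h2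
  exact Fin.sub_one_ne i h2

theorem IsKuhnCycle.flip (h : IsKuhnCycle z τ) (i : Fin (N + 2)) :
    IsKuhnCycle (Function.update z i (flipVertex z τ i)) (τ * Equiv.swap (i - 1) i) := by
  intro j
  rw [Equiv.Perm.mul_apply]
  by_cases hj : j = i
  · subst hj
    rw [Function.update_of_ne (Fin.add_one_ne j), Function.update_self, Equiv.swap_apply_right,
      h j, h.eq_sub_one j, flipVertex]
    abel
  · by_cases hj2 : j = i - 1
    · subst hj2
      rw [sub_add_cancel, Function.update_self, Function.update_of_ne hj, Equiv.swap_apply_left,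
        flipVertex]
    · have hj3 : j + 1 ≠ i := fun h => hj2 (eq_sub_of_add_eq h)
      rw [Function.update_of_ne hj3, Function.update_of_ne hj,
        Equiv.swap_apply_of_ne_of_ne hj2 hj, h j]

theorem IsRoom.flip (h : IsRoom M z τ) (i : Fin (N + 2)) (hi : ∀ k, -1 ≤ flipVertex z τ i k) :
    IsRoom M (Function.update z i (flipVertex z τ i)) (τ * Equiv.swap (i - 1) i) where
  cycle := h.cycle.flip i
  neg_one_le j := by
    by_cases hj : j = i
    · subst hj; simpa using hi
    · simpa [hj] using h.neg_one_le j
  sum_eq j := by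
    by_cases hj : j = i
    · subst hj
      simp [flipVertex, Finset.sum_add_distrib, sum_transfer, h.sum_eq]
    · simpa [hj] using h.sum_eq j
  weight_eq j := by
    by_cases hj : j = i
    · subst hj
      rw [Function.update_self, flipVertex, weight_add, weight_transfer]
      rw [← h.weight_eq (j - 1)]
      abel
    · simpa [hj] using h.weight_eq j

theorem finite_rooms (N M : ℕ) :
    {x : (Fin (N + 2) → Fin (N + 2) → ℤ) × Equiv.Perm (Fin (N + 2)) |
      IsRoom M x.1 x.2}.Finite := by
  refine ((Set.Finite.pi' fun _ : Fin (N + 2) => Set.Finite.pi' fun _ : Fin (N + 2) =>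
    Set.finite_Icc (-1 : ℤ) (M + (N + 2))).prod Set.finite_univ).subset ?_
  rintro ⟨z, τ⟩ h
  refine ⟨fun i k => ⟨h.neg_one_le i k, ?_⟩, trivial⟩
  have h1 := h.sum_eq i
  have h2 : ∑ j, (z i j + 1) = M + (N + 2) := by
    rw [Finset.sum_add_distrib, h1]
    simp
  have h3 : z i k + 1 ≤ _ := Finset.single_le_sum (f := fun j => z i j + 1) (s := Finset.univ)
    (fun j _ => by have := h.neg_one_le i j; linarith) (Finset.mem_univ k)
  linarith

open Classical in
/-- The extension of a labelling to points with a negative coordinate. -/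
noncomputable def extendLabel (l : Fin (N + 2) → (Fin (N + 2) → ℤ) → Fin (N + 2))
    (i : Fin (N + 2)) (y : Fin (N + 2) → ℤ) : Fin (N + 2) :=
  if 0 ≤ y then l i y else if h : ∃ a ≠ 1, 1 ≤ y a then h.choose else 1

section

variable {l : Fin (N + 2) → (Fin (N + 2) → ℤ) → Fin (N + 2)} {y : Fin (N + 2) → ℤ}
  {i : Fin (N + 2)}

/-- This is the Sperner boundary condition on the region enlarged by a layer of points with
coordinates `-1`. The layer is there so that exactly one door leads outside. -/
theorem one_le_extendLabel (hM : 0 < M)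
    (hl : ∀ i (y : Fin (N + 2) → ℤ), 0 ≤ y → ∑ k, y k = (M : ℤ) → 1 ≤ y (l i y))
    (hy : ∑ k, y k = (M : ℤ)) :
    1 ≤ y (extendLabel l i y) := by
  rw [extendLabel]
  split_ifs with h1 h2
  · exact hl i y h1 hy
  · exact h2.choose_spec.2
  · by_contra h3
    push Not at h2 h3
    have : ∑ k, y k ≤ 0 := Finset.sum_nonpos fun k _ => by
      by_cases hk : k = 1
      · subst hk; omega
      · have := h2 k hk; omega
    omega

theorem le_zero_of_extendLabel_eq_one (hy : ¬ 0 ≤ y) (h : extendLabel l i y = 1)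
    {a : Fin (N + 2)} (ha : a ≠ 1) : y a ≤ 0 := by
  rw [extendLabel, if_neg hy] at h
  split_ifs at h with h2
  · exact absurd h h2.choose_spec.1
  · push Not at h2
    have := h2 a ha
    omega

end

/-- The vertices of `z` except `z i` carry all labels except `0`. -/
def IsDoor (l : Fin (N + 2) → (Fin (N + 2) → ℤ) → Fin (N + 2))
    (z : Fin (N + 2) → Fin (N + 2) → ℤ) (i : Fin (N + 2)) : Prop :=
  ∀ a ≠ 0, ∃ j ≠ i, l j (z j) = a

/-- The vertices of the only simplex with a door to the outside. -/
def gate (N M : ℕ) (q : Fin (N + 2)) : Fin (N + 2) → ℤ :=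
  Pi.single 1 (M : ℤ) - Pi.single 0 1 + Pi.single (-((M : ℤ) • 1) - q) 1

theorem sum_gate (N M : ℕ) (q : Fin (N + 2)) : ∑ k, gate N M q k = M := by
  simp [gate, Finset.sum_add_distrib, Finset.sum_sub_distrib]

/-- The weight of `M e₁ - e₀ + e_a` is `M + a`, so the weight condition puts this vertex at position
`-M - a`. -/
theorem isRoom_gate (N : ℕ) (hM : 0 < M) :
    IsRoom M (gate N M) (Equiv.subLeft (-((M : ℤ) • 1) - 1)) where
  cycle i := by
    have h1 : -((M : ℤ) • (1 : Fin (N + 2))) - (i + 1) = -((M : ℤ) • 1) - 1 - i := by abel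
    have h2 : -((M : ℤ) • (1 : Fin (N + 2))) - 1 - i + 1 = -((M : ℤ) • 1) - i := by abel
    simp only [gate, transfer, Equiv.subLeft_apply, h1, h2]
    abel
  neg_one_le i k := by
    simp only [gate, Pi.add_apply, Pi.sub_apply, Pi.single_apply]
    split_ifs <;> omega
  sum_eq := sum_gate N M
  weight_eq i := by
    have h : gate N M i + Pi.single 0 1 =
        Pi.single 1 (M : ℤ) + Pi.single (-((M : ℤ) • 1) - i) 1 := by
      rw [gate]; abel
    have h2 := congrArg weight h
    simp only [weight_add, weight_single, one_smul, add_zero] at h2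
    rw [h2]
    abel

/-- The door of the gate leads outside: crossing it would produce a coordinate below `-1`. -/
theorem flipVertex_gate (N M : ℕ) :
    flipVertex (gate N M) (Equiv.subLeft (-((M : ℤ) • 1) - 1)) (-((M : ℤ) • 1)) 0 = -2 := by
  have h : -((M : ℤ) • (1 : Fin (N + 2))) - (-((M : ℤ) • 1) - 1) = 1 := by abel
  have h2 : -((M : ℤ) • (1 : Fin (N + 2))) - 1 - -((M : ℤ) • 1) = -1 := by abel
  rw [flipVertex, gate, h, Equiv.subLeft_apply, h2]
  simp [transfer_apply]

/-- For `a ≠ 0` the vertex `M e₁ - e₀ + e_a` is positive only at `1` and `a`. `extendLabel` avoids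
`1` if it can, so the label is `a`. -/
theorem isDoor_gate (l : Fin (N + 2) → (Fin (N + 2) → ℤ) → Fin (N + 2)) :
    IsDoor (extendLabel l) (gate N M) (-((M : ℤ) • 1)) := by
  intro a ha
  refine ⟨-((M : ℤ) • 1) - a, by simpa using ha, ?_⟩
  have hval : gate N M (-((M : ℤ) • 1) - a) =
      Pi.single 1 (M : ℤ) - Pi.single 0 1 + Pi.single a 1 := by
    rw [gate, sub_sub_cancel]
  rw [hval, extendLabel, if_neg]
  · split_ifs with h
    · have hspec := h.choose_spec
      generalize h.choose = b at hspec ⊢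
      obtain ⟨h1, h2⟩ := hspec
      by_contra h3
      simp only [Pi.add_apply, Pi.sub_apply, Pi.single_apply, if_neg h1, if_neg h3] at h2
      split_ifs at h2 <;> omega
    · by_contra h3
      refine h ⟨a, Ne.symm h3, ?_⟩
      simp [ha, Ne.symm h3]
  · intro h
    have := h 0
    simp [Ne.symm ha] at this

theorem add_one_le_of_sum_eq {y : Fin (N + 2) → ℤ} (h0 : y 0 = -1) (h1 : ∀ a ≠ 1, y a ≤ 0)
    (hy : ∑ k, y k = (M : ℤ)) : (M : ℤ) + 1 ≤ y 1 := by
  have h : ∑ k, y k ≤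
      ∑ k : Fin (N + 2), ((if k = 1 then y 1 else 0) - (if k = 0 then (1 : ℤ) else 0)) := by
    refine Finset.sum_le_sum fun k _ => ?_
    by_cases hk1 : k = 1
    · subst hk1
      simp
    · by_cases hk0 : k = 0
      · subst hk0
        simp [h0]
      · simpa [hk1, hk0] using h1 k hk1
  rw [hy, Finset.sum_sub_distrib] at h
  simp at h
  omega

/-- If the flip leaves the region at coordinate `k`, all vertices except `z i` have coordinate `k`
equal to `-1` and lack label `k`, so `k = 0`. The door supplies all other labels, which makes all
other coordinates nonnegative. Where the label is `1`, coordinate `1` is at least `M + 1`; so it is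
at least `M` everywhere. With sum `M`, a vertex other than `z i` with label `a` can only be `M e₁ -
e₀ + e_a`, and its weight determines `a`. -/
theorem eq_gate_of_isDoor {l : Fin (N + 2) → (Fin (N + 2) → ℤ) → Fin (N + 2)} (hM : 0 < M)
    (hl : ∀ i (y : Fin (N + 2) → ℤ), 0 ≤ y → ∑ k, y k = (M : ℤ) → 1 ≤ y (l i y))
    (h : IsRoom M z τ)
    {i : Fin (N + 2)} (hd : IsDoor (extendLabel l) z i) (hi : ¬ ∀ k, -1 ≤ flipVertex z τ i k) :
    (z, τ, i) =
      (gate N M, Equiv.subLeft (-((M : ℤ) • (1 : Fin (N + 2))) - 1), -((M : ℤ) • 1)) := by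
  have hlab : ∀ q, 1 ≤ z q (extendLabel l q (z q)) := fun q =>
    one_le_extendLabel hM hl (h.sum_eq q)
  push Not at hi
  obtain ⟨k, hk⟩ := hi
  have hz1 := h.neg_one_le (i - 1) k
  have hz2 := h.neg_one_le (i + 1) k
  rw [h.cycle i] at hz2
  have hz3 := congrFun (h.cycle.eq_sub_one i) k
  simp only [flipVertex, Pi.add_apply] at hk hz2 hz3
  rw [transfer_apply] at hk hz2 hz3
  have hki : τ i + 1 = k := by
    by_contra hne
    rw [if_neg hne] at hk
    split_ifs at hk <;> omega
  have hki2 : τ i ≠ k := by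
    rintro rfl
    exact Fin.add_one_ne _ hki
  rw [if_neg hki2, if_pos hki] at hk hz2
  have hki3 : τ (i - 1) = k := by
    by_contra hne
    rw [if_neg hne] at hz3
    split_ifs at hz3 <;> omega
  have hki4 : τ (i - 1) + 1 ≠ k := by
    rw [hki3]
    exact Fin.add_one_ne k
  rw [if_pos hki3, if_neg hki4] at hz3
  -- Only the moves into and out of `z i` affect coordinate `k`; subtracting the excess 1 at `z i`
  -- leaves a constant.
  have hconst : ∀ j, z j k - (if j = i then 1 else 0) = z i k - (if i = i then 1 else 0) :=
    Fin.eq_of_forall_add_one (h := fun j => z j k - (if j = i then 1 else 0)) (fun j => by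
      simp only [h.cycle j, Pi.add_apply, transfer_apply]
      have e1 : τ j = k ↔ j + 1 = i := by
        rw [← hki3, τ.injective.eq_iff, eq_sub_iff_add_eq]
      have e2 : τ j + 1 = k ↔ j = i := by
        rw [← hki, add_left_inj, τ.injective.eq_iff]
      simp only [e1, e2]
      ring) i
  have hzk : ∀ j ≠ i, z j k = -1 := by
    intro j hj
    have := hconst j
    rw [if_neg hj, if_pos rfl] at this
    omega
  have hk0 : k = 0 := by
    by_contra hk0
    obtain ⟨j, hj, hjl⟩ := hd k hk0
    have h1 := hlab j
    rw [hjl, hzk j hj] at h1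
    omega
  subst hk0
  have hneg : ∀ j ≠ i, ¬ 0 ≤ z j := fun j hj h0 => by
    have h1 := h0 0
    have h2 := hzk j hj
    simp only [Pi.zero_apply] at h1
    omega
  have hne0 : ∀ j ≠ i, extendLabel l j (z j) ≠ 0 := fun j hj h0 => by
    have h1 := hlab j
    rw [h0, hzk j hj] at h1
    omega
  have hnn : ∀ q, ∀ b ≠ 0, 0 ≤ z q b := by
    intro q b hb
    obtain ⟨r, -, hr⟩ := hd b hb
    have h1 := hlab r
    rw [hr] at h1
    have h2 := abs_le.1 (h.cycle.abs_coord_sub_le b r q)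
    omega
  have hle : ∀ (q : Fin (N + 2)) (a : Fin (N + 2)),
      (∀ b, (Pi.single 1 (M : ℤ) - Pi.single 0 1 + Pi.single a 1 : Fin (N + 2) → ℤ) b ≤ z q b) →
      z q = Pi.single 1 (M : ℤ) - Pi.single 0 1 + Pi.single a 1 := by
    intro q a hqa
    funext b
    refine ((Finset.sum_eq_sum_iff_of_le fun b _ => hqa b).1 ?_ b (Finset.mem_univ b)).symm
    rw [h.sum_eq]
    simp [Finset.sum_add_distrib, Finset.sum_sub_distrib]
  obtain ⟨p, hp, hpl⟩ := hd 1 one_ne_zero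
  have hp1 : (M : ℤ) + 1 ≤ z p 1 := by
    refine add_one_le_of_sum_eq (hzk p hp) (fun b hb => ?_) (h.sum_eq p)
    exact le_zero_of_extendLabel_eq_one (hneg p hp) hpl hb
  have hform : ∀ q ≠ i, z q = Pi.single 1 (M : ℤ) - Pi.single 0 1 +
      Pi.single (extendLabel l q (z q)) 1 := by
    intro q hq
    refine hle q _ fun b => ?_
    generalize ha : extendLabel l q (z q) = a
    have h0 := hne0 q hq
    have h1 := hlab q
    rw [ha] at h0 h1
    have h2 := hzk q hq
    have h3 := abs_le.1 (h.cycle.abs_coord_sub_le 1 p q)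
    simp only [Pi.add_apply, Pi.sub_apply, Pi.single_apply]
    by_cases hb0 : b = 0
    · subst hb0
      rw [if_neg zero_ne_one, if_pos rfl, if_neg h0.symm, h2]
      omega
    · have h4 := hnn q b hb0
      by_cases hb1 : b = 1
      · subst hb1
        by_cases ha1 : a = 1
        · subst ha1
          have h5 := add_one_le_of_sum_eq h2 (fun b hb =>
            le_zero_of_extendLabel_eq_one (hneg q hq) ha hb) (h.sum_eq q)
          rw [if_pos rfl, if_neg hb0]
          simp only [if_true]
          omega
        · rw [if_pos rfl, if_neg hb0, if_neg (Ne.symm ha1)]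
          omega
      · rw [if_neg hb1, if_neg hb0]
        split_ifs with hba
        · subst hba; omega
        · omega
  have hlabel : ∀ q ≠ i, extendLabel l q (z q) = -((M : ℤ) • 1) - q := by
    intro q hq
    have h1 := h.weight_eq q
    have h2 : z q + Pi.single 0 1 = Pi.single 1 (M : ℤ) +
        Pi.single (extendLabel l q (z q)) 1 := by
      conv_lhs => rw [hform q hq]
      abel
    have h3 := congrArg weight h2
    simp only [weight_add, weight_single, one_smul, smul_zero, add_zero] at h3
    rw [h3] at h1
    rw [← sub_eq_zero, ← h1]
    abel
  -- Otherwise vertex number `-M` would carry label `0`, although its coordinate `0` is `-1`.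
  have his : i = -((M : ℤ) • 1) := by
    by_contra hne
    have h1 := hlabel _ (Ne.symm hne)
    rw [sub_self] at h1
    exact hne0 _ (Ne.symm hne) h1
  have hz : z = gate N M := by
    have hother : ∀ q ≠ i, z q = gate N M q := fun q hq => by
      rw [gate, ← hlabel q hq]
      exact hform q hq
    funext q
    by_cases hq : q = i
    · rw [hq, h.cycle.eq_sub_one i, hother _ (Fin.sub_one_ne i), hki3, gate, gate, transfer,
        zero_add]
      have e1 : -((M : ℤ) • 1) - (i - 1) = 1 := by rw [his]; abel
      have e2 : -((M : ℤ) • 1) - i = 0 := by rw [his]; abel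
      rw [e1, e2]
      abel
    · rw [hother q hq]
  have hτ : τ = Equiv.subLeft (-((M : ℤ) • 1) - 1) := by
    ext1 q
    apply transfer_injective
    have h1 := h.cycle q
    rw [hz, (isRoom_gate N hM).cycle q] at h1
    exact (add_left_cancel h1).symm
  rw [hz, hτ, his]

/-- If there is a door, all nonzero labels occur, so non-surjectivity means that `0` is missing.
Then exactly one label occurs twice, and the doors are obtained by omitting either of its two
vertices. -/
theorem even_card_doors (L : Fin (N + 2) → Fin (N + 2)) (hL : ¬ Function.Bijective L) :
    ((Finset.univ.filter fun i => ∀ a ≠ 0, ∃ j ≠ i, L j = a).card : ZMod 2) = 0 := by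
  classical
  have hL' : ¬ Function.Surjective L := fun h => hL (Finite.surjective_iff_bijective.1 h)
  rcases (Finset.univ.filter fun i => ∀ a ≠ 0, ∃ j ≠ i, L j = a).eq_empty_or_nonempty with
    h | ⟨i, hi⟩
  · rw [h]; simp
  · simp only [Finset.mem_filter, Finset.mem_univ, true_and] at hi
    have h0 : ∀ j, L j ≠ 0 := fun j hj => hL' fun a => by
      by_cases ha : a = 0
      · exact ⟨j, hj.trans ha.symm⟩
      · obtain ⟨j', -, hj'⟩ := hi a ha
        exact ⟨j', hj'⟩
    obtain ⟨i', hi', hLi⟩ := hi (L i) (h0 i)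
    have hinj : Set.InjOn L (Finset.univ.erase i : Finset (Fin (N + 2))) := by
      refine Finset.injOn_of_surjOn_of_card_le (t := Finset.univ.erase 0) L ?_ ?_ ?_
      · intro j _
        simpa using h0 j
      · intro a ha
        obtain ⟨j, hj, hja⟩ := hi a (by simpa using ha)
        exact ⟨j, by simpa using hj, hja⟩
      · simp
    have hset : (Finset.univ.filter fun i => ∀ a ≠ 0, ∃ j ≠ i, L j = a) = {i, i'} := by
      ext j
      simp only [Finset.mem_filter, Finset.mem_univ, true_and, Finset.mem_insert,
        Finset.mem_singleton]
      constructor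
      · intro hj
        by_contra! hne
        obtain ⟨j', hj', hLj⟩ := hj (L j) (h0 j)
        by_cases hj'i : j' = i
        · refine hne.2 (hinj (by simpa using hne.1) (by simpa using hi') ?_)
          rw [hLi, ← hLj, hj'i]
        · exact hj' (hinj (by simpa using hj'i) (by simpa using hne.1) hLj)
      · rintro (rfl | rfl)
        · exact hi
        · intro a ha
          obtain ⟨j', hj', hLj⟩ := hi a ha
          by_cases h : j' = j
          · exact ⟨i, hi'.symm, by rw [← hLi, ← hLj, h]⟩
          · exact ⟨j', h, hLj⟩
    rw [hset, Finset.card_pair hi'.symm]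
    rfl

/-- **Sperner's lemma** for the Kuhn triangulation of a simplex, in the form in which the
labelling may depend on the position of a vertex in the simplex (with positions assigned
consistently): there is a simplex whose vertices carry all labels. -/
theorem exists_bijective_label (hM : 0 < M)
    (l : Fin (N + 2) → (Fin (N + 2) → ℤ) → Fin (N + 2))
    (hl : ∀ i (y : Fin (N + 2) → ℤ), 0 ≤ y → ∑ k, y k = (M : ℤ) → 1 ≤ y (l i y)) :
    ∃ (z : Fin (N + 2) → Fin (N + 2) → ℤ) (τ : Equiv.Perm (Fin (N + 2))), IsKuhnCycle z τ ∧
      (∀ i, 0 ≤ z i) ∧ (∀ i, ∑ k, z i k = (M : ℤ)) ∧ Function.Bijective fun i => l i (z i) := by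
  classical
  -- A fully labelled room avoids the added layer: the vertex labelled `k` has coordinate `k` at
  -- least 1, and coordinates vary by at most 1.
  suffices hfull : ∃ (z : Fin (N + 2) → Fin (N + 2) → ℤ) (τ : Equiv.Perm (Fin (N + 2))),
      IsRoom M z τ ∧ Function.Bijective fun i => extendLabel l i (z i) by
    obtain ⟨z, τ, h, hbij⟩ := hfull
    have hnn : ∀ i, 0 ≤ z i := by
      intro i k
      obtain ⟨j, hj⟩ := hbij.2 k
      have h1 := one_le_extendLabel (i := j) hM hl (h.sum_eq j)
      simp only at hj
      rw [hj] at h1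
      have h2 := abs_le.1 (h.cycle.abs_coord_sub_le k j i)
      simp only [Pi.zero_apply]
      omega
    refine ⟨z, τ, h.cycle, hnn, h.sum_eq, ?_⟩
    simpa only [extendLabel, if_pos (hnn _)] using hbij
  by_contra hno
  push Not at hno
  set R := (finite_rooms N M).toFinset
  have hR : ∀ x, x ∈ R ↔ IsRoom M x.1 x.2 := fun x => by simp [R]
  set D := (((finite_rooms N M).prod Set.finite_univ).toFinset.image
    fun x : _ × Fin (N + 2) => (x.1.1, x.1.2, x.2)).filter
      fun x => IsDoor (extendLabel l) x.1 x.2.2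
  have hD : ∀ x, x ∈ D ↔ IsRoom M x.1 x.2.1 ∧ IsDoor (extendLabel l) x.1 x.2.2 := by
    rintro ⟨z, τ, i⟩
    simp [D]
  -- Counted room by room, the doors are even in number if no room is fully labelled.
  have heven : ∑ _x ∈ D, (1 : ZMod 2) = 0 := by
    rw [← Finset.sum_fiberwise_of_maps_to (t := R) (g := fun x => (x.1, x.2.1))]
    · refine Finset.sum_eq_zero fun r hr => ?_
      rw [hR] at hr
      have h1 := even_card_doors (fun i => extendLabel l i (r.1 i)) (hno r.1 r.2 hr)
      rw [Finset.sum_const, nsmul_one, ← h1]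
      congr 1
      refine Finset.card_nbij' (fun x => x.2.2) (fun i => (r.1, r.2, i)) ?_ ?_ ?_ ?_
      · rintro x hx
        simp only [Finset.coe_filter, Set.mem_ofPred_eq, hD] at hx
        simp only [Finset.coe_filter, Set.mem_ofPred_eq, Finset.mem_univ, true_and]
        rw [← hx.2]
        exact hx.1.2
      · intro i hi
        simp only [Finset.coe_filter, Set.mem_ofPred_eq, Finset.mem_univ, true_and] at hi
        simp only [Finset.coe_filter, Set.mem_ofPred_eq, hD]
        exact ⟨⟨hr, hi⟩, trivial⟩
      · rintro x hx
        simp only [Finset.coe_filter, Set.mem_ofPred_eq] at hx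
        rw [← hx.2]
      · intro i _
        rfl
    · intro x hx
      rw [hD] at hx
      rw [hR]
      exact hx.1
  set g : (Fin (N + 2) → Fin (N + 2) → ℤ) × Equiv.Perm (Fin (N + 2)) × Fin (N + 2) :=
    (gate N M, Equiv.subLeft (-((M : ℤ) • (1 : Fin (N + 2))) - 1), -((M : ℤ) • 1)) with hg
  have hgD : g ∈ D := (hD g).2 ⟨isRoom_gate N hM, isDoor_gate l⟩
  have hflipdoor : ∀ x, IsDoor (extendLabel l) x.1 x.2.2 →
      IsDoor (extendLabel l) (flip x).1 (flip x).2.2 := by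
    intro x hx a ha
    obtain ⟨j, hj, hja⟩ := hx a ha
    refine ⟨j, hj, ?_⟩
    simp only [flip]
    rw [Function.update_of_ne hj, hja]
  -- Flipping pairs off all doors except the gate, so the total is also odd.
  have hodd : ∑ _x ∈ D.erase g, (1 : ZMod 2) = 0 := by
    refine Finset.sum_involution (fun x _ => flip x) (fun _ _ => rfl) ?_ ?_ ?_
    · rintro ⟨z, τ, i⟩ _ _
      exact flip_ne z τ i
    · rintro ⟨z, τ, i⟩ hx
      rw [Finset.mem_erase, hD] at hx
      rw [Finset.mem_erase, hD]
      refine ⟨fun hflip => ?_, ⟨?_, hflipdoor _ hx.2.2⟩⟩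
      -- A door that flips to the gate would lie in a room with coordinate `-2`.
      · have h1 := flip_flip hx.2.1.cycle i
        rw [hflip] at h1
        have h2 := hx.2.1.neg_one_le (-((M : ℤ) • 1)) 0
        have h3 : z = (flip g).1 := by rw [h1]
        simp only at h2
        have h4 : (flip g).1 (-((M : ℤ) • 1)) 0 = -2 := by
          simp only [hg, flip, Function.update_self]
          exact flipVertex_gate N M
        rw [h3, h4] at h2
        omega
      · by_contra hnot
        refine hx.1 (eq_gate_of_isDoor hM hl hx.2.1 hx.2.2 fun hk => hnot ?_)
        exact hx.2.1.flip i hk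
    · rintro ⟨z, τ, i⟩ hx
      rw [Finset.mem_erase, hD] at hx
      exact flip_flip hx.2.1.cycle i
  rw [← Finset.add_sum_erase D _ hgD, hodd] at heven
  exact absurd heven (by decide)

end Sperner

/-! ### From nearby divisions of a line to an EF1 allocation -/

section Rounding

variable {n m N : ℕ}

/-- The right end of the first `j` of consecutive intervals with the lengths `y`. -/
def cut (j : ℕ) : (Fin n → ℤ) →+ ℤ := ∑ k : Fin n with k.val < j, Pi.evalAddMonoidHom _ k

theorem cut_apply (j : ℕ) (y : Fin n → ℤ) : cut j y = ∑ k : Fin n with k.val < j, y k := by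
  simp [cut]

theorem cut_zero (y : Fin n → ℤ) : cut 0 y = 0 := by simp [cut_apply]

theorem cut_of_le {j : ℕ} (hj : n ≤ j) (y : Fin n → ℤ) : cut j y = ∑ k, y k := by
  rw [cut_apply, Finset.filter_true_of_mem]
  intro k _
  exact k.2.trans_le hj

theorem cut_succ (k : Fin n) (y : Fin n → ℤ) : cut (k.val + 1) y = cut k.val y + y k := by
  rw [cut_apply, cut_apply, add_comm _ (y k), ← Finset.sum_insert (by simp)]
  refine Finset.sum_congr ?_ fun _ _ => rfl
  ext a
  simp only [Finset.mem_filter, Finset.mem_univ, true_and, Finset.mem_insert, Fin.ext_iff]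
  omega

theorem cut_mono {y : Fin n → ℤ} (hy : 0 ≤ y) {j j' : ℕ} (h : j ≤ j') : cut j y ≤ cut j' y := by
  rw [cut_apply, cut_apply]
  refine Finset.sum_le_sum_of_subset_of_nonneg ?_ fun k _ _ => hy k
  intro k
  simp only [Finset.mem_filter, Finset.mem_univ, true_and]
  omega

/-- An inner cut `j` is raised only by move `j - 1`, and lowered only by the last move, which
carries a unit from coordinate `0` to the last one. -/
theorem IsKuhnCycle.abs_cut_sub_le {z : Fin (N + 2) → Fin (N + 2) → ℤ}
    {τ : Equiv.Perm (Fin (N + 2))} (h : IsKuhnCycle z τ) {M : ℤ} (hM : ∀ i, ∑ k, z i k = M)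
    (j : ℕ) (i i' : Fin (N + 2)) : |cut j (z i') - cut j (z i)| ≤ 1 := by
  rcases Nat.eq_zero_or_pos j with rfl | hj
  · simp [cut_zero]
  rcases le_or_gt (N + 2) j with hj2 | hj2
  · simp [cut_of_le hj2, hM]
  refine h.abs_sub_le (cut j) ⟨j - 1, by omega⟩ (Fin.last _) (fun a => ?_) i i'
  have h1 : cut j (transfer a) =
      (if a.val < j then 1 else 0) - (if (a + 1).val < j then 1 else 0) := by
    simp only [transfer, map_sub, cut_apply, Finset.sum_pi_single', Finset.mem_filter,
      Finset.mem_univ, true_and]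
  rw [h1]
  by_cases ha : a = Fin.last _
  · subst ha
    have h2 : ¬ (Fin.last (N + 1)).val < j := by rw [Fin.val_last]; omega
    have h3 : Fin.last (N + 1) ≠ ⟨j - 1, by omega⟩ := by
      rw [Ne, Fin.ext_iff, Fin.val_last]; simp only; omega
    rw [if_neg h2, if_neg h3, Fin.last_add_one]
    simp [hj]
  · have h2 : (a + 1).val = a.val + 1 := Fin.val_add_one_of_lt (Fin.lt_last_iff_ne_last.2 ha)
    have h3 : a = ⟨j - 1, by omega⟩ ↔ a.val = j - 1 := Fin.ext_iff
    rw [h2, if_neg ha]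
    simp only [h3]
    split_ifs <;> omega

/-- The items between `a` and `b`, if item `e` extends from `2 * e` to `2 * e + 2`. -/
def itemsBetween (m : ℕ) (a b : ℤ) : Finset (Fin m) :=
  Finset.univ.filter fun e => a ≤ 2 * (e.val : ℤ) ∧ 2 * (e.val : ℤ) + 2 ≤ b

theorem mem_itemsBetween {a b : ℤ} {e : Fin m} :
    e ∈ itemsBetween m a b ↔ a ≤ 2 * (e.val : ℤ) ∧ 2 * (e.val : ℤ) + 2 ≤ b := by
  simp [itemsBetween]

/-- The items that lie within interval number `k` if the intervals have the lengths `y`. -/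
def piece (m : ℕ) (y : Fin n → ℤ) (k : Fin n) : Finset (Fin m) :=
  itemsBetween m (cut k y) (cut (k + 1) y)

theorem mem_piece {y : Fin n → ℤ} {k : Fin n} {e : Fin m} :
    e ∈ piece m y k ↔ cut k y ≤ 2 * (e.val : ℤ) ∧ 2 * (e.val : ℤ) + 2 ≤ cut (k + 1) y :=
  mem_itemsBetween

/-- Intervals of nonpositive length hold no items, so by monotonicity they can be passed over. The
positive length is what Sperner's lemma asks of a label. -/
theorem exists_best_piece {u : Valuation m} (hu : Monotone u) {y : Fin n → ℤ}
    (hsum : 0 < ∑ k, y k) : ∃ k, 1 ≤ y k ∧ ∀ k', u (piece m y k') ≤ u (piece m y k) := by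
  have hpos : (Finset.univ.filter fun k => 1 ≤ y k).Nonempty := by
    by_contra hne
    rw [Finset.not_nonempty_iff_eq_empty, Finset.filter_eq_empty_iff] at hne
    refine hsum.not_ge (Finset.sum_nonpos fun k hk => ?_)
    have := hne hk
    omega
  obtain ⟨k, hk, hmax⟩ := Finset.exists_max_image _ (fun k => u (piece m y k)) hpos
  rw [Finset.mem_filter] at hk
  refine ⟨k, hk.2, fun k' => ?_⟩
  by_cases hk' : 1 ≤ y k'
  · exact hmax k' (by simpa using hk')
  · have h0 : piece m y k' = ∅ := by
      rw [Finset.eq_empty_iff_forall_notMem]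
      intro e he
      rw [mem_piece, cut_succ] at he
      omega
    rw [h0]
    exact hu (Finset.empty_subset _)

/-- Bundles from the cyclic sequence `z` of divisions in which the division `z (o k)` determines
bundle `k`. -/
def mixedPiece (m : ℕ) (z : Fin n → Fin n → ℤ) (o : Fin n → Fin n) (k : Fin n) :
    Finset (Fin m) := piece m (z (o k)) k

section Mixed

variable {z : Fin (N + 2) → Fin (N + 2) → ℤ} {τ : Equiv.Perm (Fin (N + 2))}
  (o : Fin (N + 2) → Fin (N + 2))

/-- A common item, of length 2, would need the cut between the two bundles to move by 2 between
divisions. -/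
theorem disjoint_mixedPiece (h : IsKuhnCycle z τ) (hz : ∀ i, 0 ≤ z i)
    (hsum : ∀ i, ∑ k, z i k = (2 * m : ℕ)) {k k' : Fin (N + 2)} (hk : k ≠ k') :
    Disjoint (mixedPiece m z o k) (mixedPiece m z o k') := by
  wlog hlt : k < k' generalizing k k'
  · exact (this hk.symm (lt_of_le_of_ne (not_lt.1 hlt) hk.symm)).symm
  rw [Finset.disjoint_left]
  intro e he he'
  rw [mixedPiece, mem_piece] at he he'
  have h1 := abs_le.1 (h.abs_cut_sub_le hsum (k + 1) (o k) (o k'))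
  have h2 : cut (k + 1) (z (o k')) ≤ cut k' (z (o k')) := cut_mono (hz _) hlt
  omega

/-- Each end moves by at most 1 and so excludes at most one item. Both ends cannot move inwards, as
the length changes by at most 1. -/
theorem card_mixedPiece_sdiff_le (h : IsKuhnCycle z τ)
    (hsum : ∀ i, ∑ k, z i k = (2 * m : ℕ)) (k i : Fin (N + 2)) :
    (mixedPiece m z o k \ piece m (z i) k).card ≤ 1 := by
  rw [Finset.card_le_one]
  intro e he e' he'
  by_contra hne
  wlog hlt : e < e' generalizing e e'
  · exact this e' he' e he (Ne.symm hne) (lt_of_le_of_ne (not_lt.1 hlt) (Ne.symm hne))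
  rw [Finset.mem_sdiff, mixedPiece, mem_piece, mem_piece, cut_succ, cut_succ] at he he'
  have h1 := abs_le.1 (h.abs_cut_sub_le hsum k i (o k))
  have h2 := abs_le.1 (h.abs_cut_sub_le hsum (k + 1) i (o k))
  have h3 := abs_le.1 (h.abs_coord_sub_le k i (o k))
  rw [cut_succ, cut_succ] at h2
  have hlt' : e.val < e'.val := hlt
  omega

open Classical in
/-- The items that are cut in the middle in one of the divisions. -/
noncomputable def touchedItems (m : ℕ) (z : Fin n → Fin n → ℤ) : Finset (Fin m) :=
  Finset.univ.filter fun e => ∃ (j : ℕ) (i : Fin n), cut j (z i) = 2 * (e.val : ℤ) + 1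

theorem mem_touchedItems {n m : ℕ} {z : Fin n → Fin n → ℤ} {e : Fin m} :
    e ∈ touchedItems m z ↔ ∃ (j : ℕ) (i : Fin n), cut j (z i) = 2 * (e.val : ℤ) + 1 := by
  simp [touchedItems]

/-- Cuts `0` and `N + 2` lie at the even points `0` and `2 * m`. Each of the `N + 1` inner cuts
varies by at most 1, so it meets the middle of at most one item. -/
theorem card_touchedItems_le (h : IsKuhnCycle z τ) (hsum : ∀ i, ∑ k, z i k = (2 * m : ℕ)) :
    (touchedItems m z).card ≤ N + 1 := by
  have hex : ∀ e ∈ touchedItems m z, ∃ (j : ℕ) (i : Fin (N + 2)),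
      cut j (z i) = 2 * (e.val : ℤ) + 1 := fun e he => mem_touchedItems.1 he
  choose! j i hji using hex
  have hcard : (Finset.Ioo 0 (N + 2)).card = N + 1 := by simp
  rw [← hcard]
  refine Finset.card_le_card_of_injOn j ?_ ?_
  · intro e he
    have h1 := hji e he
    rw [Finset.coe_Ioo, Set.mem_Ioo]
    constructor
    · by_contra h0
      rw [Nat.eq_zero_of_not_pos h0, cut_zero] at h1
      omega
    · by_contra h0
      rw [cut_of_le (not_lt.1 h0), hsum] at h1
      push_cast at h1
      omega
  · intro e he e' he' hee
    have h1 := hji e he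
    have h2 := hji e' he'
    rw [← hee] at h2
    have h3 := abs_le.1 (h.abs_cut_sub_le hsum (j e) (i e) (i e'))
    apply Fin.ext
    omega

theorem mem_touchedItems_of_mem_sdiff (h : IsKuhnCycle z τ)
    (hsum : ∀ i, ∑ k, z i k = (2 * m : ℕ)) {k i i' : Fin (N + 2)} {e : Fin m}
    (he : e ∈ piece m (z i) k) (he' : e ∉ piece m (z i') k) : e ∈ touchedItems m z := by
  rw [mem_touchedItems]
  rw [mem_piece] at he he'
  have h1 := abs_le.1 (h.abs_cut_sub_le hsum k i i')
  have h2 := abs_le.1 (h.abs_cut_sub_le hsum (k + 1) i i')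
  by_cases h3 : cut k (z i') ≤ 2 * (e.val : ℤ)
  · exact ⟨k + 1, i', by omega⟩
  · exact ⟨k, i', by omega⟩

theorem exists_mem_mixedPiece (h : IsKuhnCycle z τ) (hsum : ∀ i, ∑ k, z i k = (2 * m : ℕ))
    {e : Fin m} (he : e ∉ touchedItems m z) : ∃ k, e ∈ mixedPiece m z o k := by
  classical
  have hex : ∃ j, 2 * (e.val : ℤ) < cut (j + 1) (z 0) := by
    refine ⟨N + 2, ?_⟩
    rw [cut_of_le (by omega), hsum]
    have := e.2
    push_cast
    omega
  have h1 := Nat.find_spec hex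
  have hlt : Nat.find hex < N + 2 := by
    by_contra hge
    have h2 := Nat.find_min hex (m := N + 1) (by omega)
    rw [cut_of_le (by omega), hsum] at h2
    have := e.2
    push_cast at h2
    omega
  have h2 : cut (Nat.find hex) (z 0) ≤ 2 * (e.val : ℤ) := by
    rcases Nat.eq_zero_or_pos (Nat.find hex) with h0 | h0
    · rw [h0, cut_zero]; omega
    · have h3 := Nat.find_min hex (m := Nat.find hex - 1) (by omega)
      rw [Nat.sub_add_cancel h0] at h3
      omega
  refine ⟨⟨Nat.find hex, hlt⟩, ?_⟩
  have h3 : e ∈ piece m (z 0) ⟨Nat.find hex, hlt⟩ := by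
    rw [mem_piece]
    refine ⟨h2, ?_⟩
    by_contra h4
    refine he (mem_touchedItems.2 ⟨Nat.find hex + 1, 0, ?_⟩)
    simp only at h4
    omega
  by_contra h4
  exact he (mem_touchedItems_of_mem_sdiff h hsum h3 h4)

/-- The items outside the bundles `C`. -/
def leftover {n m : ℕ} (C : Fin n → Finset (Fin m)) : Finset (Fin m) :=
  Finset.univ.filter fun e => ∀ k, e ∉ C k

theorem mem_leftover {n m : ℕ} {C : Fin n → Finset (Fin m)} {e : Fin m} :
    e ∈ leftover C ↔ ∀ k, e ∉ C k := by
  simp [leftover]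

/-- A bundle that is not inside its interval in every division contains a touched item. These items
are distinct, and differ from the leftover ones, which are touched too. There are at most `N + 1`
touched items in all, so at least as many of the `N + 2` bundles are good as there are leftovers. -/
theorem exists_card_eq_leftover (hm : 0 < m) (h : IsKuhnCycle z τ) (hz : ∀ i, 0 ≤ z i)
    (hsum : ∀ i, ∑ k, z i k = (2 * m : ℕ)) :
    ∃ Q : Finset (Fin (N + 2)), (leftover (mixedPiece m z o)).card = Q.card ∧
      ∀ k ∈ Q, ∀ i, mixedPiece m z o k ⊆ piece m (z i) k := by
  classical
  set P := Finset.univ.filter fun k => ¬ ∀ i, mixedPiece m z o k ⊆ piece m (z i) k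
  have hex : ∀ k ∈ P, ∃ e, e ∈ mixedPiece m z o k ∧ e ∈ touchedItems m z := by
    intro k hk
    simp only [P, Finset.mem_filter, Finset.mem_univ, true_and, not_forall,
      Finset.not_subset] at hk
    obtain ⟨i, e, he, he'⟩ := hk
    exact ⟨e, he, mem_touchedItems_of_mem_sdiff h hsum he he'⟩
  have : Nonempty (Fin m) := ⟨⟨0, hm⟩⟩
  choose! g hg1 hg2 using hex
  have hinj : Set.InjOn g (P : Set (Fin (N + 2))) := by
    intro k hk k' hk' hkk
    by_contra hne
    have h1 := hg1 k' hk'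
    rw [← hkk] at h1
    exact Finset.disjoint_left.1 (disjoint_mixedPiece o h hz hsum hne) (hg1 k hk) h1
  have hdisj : Disjoint (leftover (mixedPiece m z o)) (P.image g) := by
    rw [Finset.disjoint_left]
    intro e he he'
    obtain ⟨k, hk, rfl⟩ := Finset.mem_image.1 he'
    exact mem_leftover.1 he k (hg1 k hk)
  have hsub : leftover (mixedPiece m z o) ∪ P.image g ⊆ touchedItems m z := by
    refine Finset.union_subset (fun e he => ?_) (Finset.image_subset_iff.2 hg2)
    by_contra he'
    obtain ⟨k, hk⟩ := exists_mem_mixedPiece o h hsum he'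
    exact mem_leftover.1 he k hk
  have hcard := (Finset.card_le_card hsub).trans (card_touchedItems_le h hsum)
  rw [Finset.card_union_of_disjoint hdisj, Finset.card_image_of_injOn hinj] at hcard
  have hcompl := P.card_compl_add_card
  rw [Fintype.card_fin] at hcompl
  obtain ⟨Q, hQP, hQ⟩ := Finset.exists_subset_card_eq
    (s := Pᶜ) (n := (leftover (mixedPiece m z o)).card) (by omega)
  refine ⟨Q, hQ.symm, fun k hk => ?_⟩
  have h1 := hQP hk
  simpa [P] using h1

end Mixed

open Classical in
/-- The bundles `C`, with the items outside them distributed among the agents in `Q`, one item to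
each. -/
noncomputable def distribute [NeZero n] (C : Fin n → Finset (Fin m)) (Q : Finset (Fin n)) :
    Allocation n m := fun e =>
  if h : ∃ k, e ∈ C k then h.choose else
    if hQ : (leftover C).card = Q.card then
      Finset.equivOfCardEq hQ ⟨e, mem_leftover.2 (not_exists.1 h)⟩ else 0

section Distribute

variable [NeZero n] {C : Fin n → Finset (Fin m)} {Q : Finset (Fin n)}

theorem subset_bundle_distribute (hC : ∀ k k', k ≠ k' → Disjoint (C k) (C k')) (k : Fin n) :
    C k ⊆ (distribute C Q).bundle k := by
  intro e he
  have h : ∃ k, e ∈ C k := ⟨k, he⟩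
  rw [Allocation.bundle, Finset.mem_filter, distribute, dif_pos h]
  refine ⟨Finset.mem_univ _, ?_⟩
  by_contra hne
  exact Finset.disjoint_left.1 (hC _ _ hne) h.choose_spec he

theorem distribute_of_notMem (hQ : (leftover C).card = Q.card) {k : Fin n} {e : Fin m}
    (he : e ∈ (distribute C Q).bundle k) (he' : e ∉ C k) :
    ∃ h : e ∈ leftover C, (Finset.equivOfCardEq hQ ⟨e, h⟩ : Fin n) = k := by
  rw [Allocation.bundle, Finset.mem_filter, distribute] at he
  have h : ¬ ∃ k, e ∈ C k := by
    intro h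
    rw [dif_pos h] at he
    exact he' (he.2 ▸ h.choose_spec)
  rw [dif_neg h, dif_pos hQ] at he
  exact ⟨_, he.2⟩

theorem card_bundle_distribute_sdiff_le (hQ : (leftover C).card = Q.card) (k : Fin n) :
    ((distribute C Q).bundle k \ C k).card ≤ 1 := by
  rw [Finset.card_le_one]
  intro e he e' he'
  rw [Finset.mem_sdiff] at he he'
  obtain ⟨h, hk⟩ := distribute_of_notMem hQ he.1 he.2
  obtain ⟨h', hk'⟩ := distribute_of_notMem hQ he'.1 he'.2
  have h1 := (Finset.equivOfCardEq hQ).injective (Subtype.ext (hk.trans hk'.symm))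
  exact congrArg Subtype.val h1

theorem bundle_distribute_of_notMem (hC : ∀ k k', k ≠ k' → Disjoint (C k) (C k'))
    (hQ : (leftover C).card = Q.card) {k : Fin n} (hk : k ∉ Q) :
    (distribute C Q).bundle k = C k := by
  refine Finset.Subset.antisymm (fun e he => ?_) (subset_bundle_distribute hC k)
  by_contra he'
  obtain ⟨h, hk'⟩ := distribute_of_notMem hQ he he'
  exact hk (hk' ▸ (Finset.equivOfCardEq hQ ⟨e, h⟩).2)

end Distribute

/-- Here `B i j` is interval `j` as it appears in agent `i`'s own division, where her own interval
is her favourite. -/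
theorem isEF1_of_card_sdiff_le {v : Fin n → Valuation m} (hv : ∀ i, Monotone (v i))
    {A : Allocation n m} (B : Fin n → Fin n → Finset (Fin m))
    (hown : ∀ i, B i i ⊆ A.bundle i) (hbest : ∀ i j, v i (B i j) ≤ v i (B i i))
    (hother : ∀ i j, (A.bundle j \ B i j).card ≤ 1) : IsEF1 v A := by
  intro i j _
  have hle := (hbest i j).trans (hv i (hown i))
  rcases (A.bundle j \ B i j).eq_empty_or_nonempty with h | ⟨e, he⟩
  · exact Or.inl ((hv i (Finset.sdiff_eq_empty_iff_subset.1 h)).trans hle)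
  · refine Or.inr ⟨e, (Finset.mem_sdiff.1 he).1, (hv i fun e' he' => ?_).trans hle⟩
    rw [Finset.mem_sdiff, Finset.mem_singleton] at he'
    by_contra hnot
    exact he'.2 (Finset.card_le_one.1 (hother i j) e' (Finset.mem_sdiff.2 ⟨he'.1, hnot⟩) e he)

/-- The data from which the bundles of an EF1 allocation are computed: the interval lengths of
one division, the shifts of the left and the right ends of the intervals, and the set of
intervals that receive an additional item. -/
abbrev AllocationCode (n m : ℕ) : Type :=
  Finset.finsuppAntidiag (Finset.univ : Finset (Fin n)) (2 * m) × (Fin n → Fin 3) ×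
    (Fin n → Fin 3) × Finset (Fin n)

/-- The allocation of the intervals with the given code. -/
noncomputable def AllocationCode.decode [NeZero n] (K : AllocationCode n m) : Allocation n m :=
  distribute (fun k => itemsBetween m
    (cut k (fun k => (K.1.val k : ℤ)) + K.2.1 k - 1)
    (cut (k + 1) (fun k => (K.1.val k : ℤ)) + K.2.2.1 k - 1)) K.2.2.2

theorem exists_code_of_isKuhnCycle {z : Fin (N + 2) → Fin (N + 2) → ℤ}
    {τ : Equiv.Perm (Fin (N + 2))} (h : IsKuhnCycle z τ) (hz : ∀ i, 0 ≤ z i)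
    (hsum : ∀ i, ∑ k, z i k = (2 * m : ℕ)) (o : Fin (N + 2) → Fin (N + 2))
    (Q : Finset (Fin (N + 2))) :
    ∃ K : AllocationCode (N + 2) m, K.decode = distribute (mixedPiece m z o) Q := by
  have hshift : ∀ (j : ℕ) (i : Fin (N + 2)), ∃ d : Fin 3,
      cut j (z 0) + (d : ℤ) - 1 = cut j (z i) := by
    intro j i
    have h1 := abs_le.1 (h.abs_cut_sub_le hsum j 0 i)
    -- The shift -1, 0 or 1 is stored as a digit 0, 1 or 2.
    refine ⟨⟨(cut j (z i) - cut j (z 0) + 1).toNat, by omega⟩, ?_⟩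
    simp only
    omega
  choose d hd using hshift
  have hcast : ∀ k, ((z 0 k).toNat : ℤ) = z 0 k := fun k => Int.toNat_of_nonneg (hz 0 k)
  refine ⟨⟨⟨Finsupp.equivFunOnFinite.symm fun k => (z 0 k).toNat, ?_⟩, fun k => d k (o k),
    fun k => d (k + 1) (o k), Q⟩, ?_⟩
  · rw [Finset.mem_finsuppAntidiag]
    refine ⟨?_, Finset.subset_univ _⟩
    zify
    simp only [Finsupp.equivFunOnFinite_symm_apply_apply, hcast]
    rw [hsum 0]
    push_cast
    rfl
  · have hfun : (fun k => ((z 0 k).toNat : ℤ)) = z 0 := funext hcast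
    simp only [AllocationCode.decode, Finsupp.equivFunOnFinite_symm_apply_apply, hfun, hd]
    rfl

/-- For monotone valuations, some coded allocation is EF1 after a permutation of the agents. -/
theorem exists_code_isEF1 [NeZero n] (hm : 0 < m) (v : Fin n → Valuation m)
    (hv : ∀ i, Monotone (v i)) :
    ∃ (K : AllocationCode n m) (π : Equiv.Perm (Fin n)), IsEF1 v fun e => π (K.decode e) := by
  obtain _ | _ | N := n
  · exact absurd rfl (NeZero.ne 0)
  -- A single agent envies nobody, so any code will do; Sperner's lemma is needed from two agents
  -- on.
  · refine ⟨⟨⟨Finsupp.single 0 (2 * m), Finset.mem_finsuppAntidiag.2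
      ⟨(Fin.sum_univ_one _).trans Finsupp.single_eq_same, Finset.subset_univ _⟩⟩, 0, 0, ∅⟩, 1, ?_⟩
    intro i j hij
    exact absurd (Fin.ext (by omega)) hij
  have hex : ∀ (i : Fin (N + 2)) (y : Fin (N + 2) → ℤ), ∑ k, y k = ((2 * m : ℕ) : ℤ) →
      ∃ k, 1 ≤ y k ∧ ∀ k', v i (piece m y k') ≤ v i (piece m y k) := fun i y hy =>
    exists_best_piece (hv i) (by rw [hy]; push_cast; omega)
  choose! l hl1 hl2 using hex
  obtain ⟨z, τ, h, hz, hsum, hbij⟩ := exists_bijective_label (M := 2 * m) (by omega) l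
    fun i y _ hy => hl1 i y hy
  set ρ := Equiv.ofBijective _ hbij with hρ
  have hρi : ∀ i, ρ i = l i (z i) := fun i => rfl
  obtain ⟨Q, hQ, hQsub⟩ := exists_card_eq_leftover ρ.symm hm h hz hsum
  obtain ⟨K, hK⟩ := exists_code_of_isKuhnCycle (m := m) h hz hsum ρ.symm Q
  have hdisj : ∀ k k', k ≠ k' →
      Disjoint (mixedPiece m z ρ.symm k) (mixedPiece m z ρ.symm k') := fun k k' hk =>
    disjoint_mixedPiece _ h hz hsum hk
  refine ⟨K, ρ.symm, ?_⟩
  have hbundle : ∀ i, Allocation.bundle (fun e => ρ.symm (K.decode e)) i =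
      K.decode.bundle (ρ i) := by
    intro i
    ext e
    simp [Allocation.bundle, Equiv.symm_apply_eq]
  refine isEF1_of_card_sdiff_le hv (fun i j => piece m (z i) (ρ j)) ?_ ?_ ?_
  · intro i
    rw [hbundle, hK]
    have h1 := subset_bundle_distribute (Q := Q) hdisj (ρ i)
    simpa only [mixedPiece, Equiv.symm_apply_apply] using h1
  · intro i j
    rw [hρi i]
    exact hl2 i (z i) (hsum i) _
  · intro i j
    rw [hbundle, hK]
    -- Bundles in `Q` lie inside the interval of every division and gain at most one item; the
    -- others may exceed it by one item and gain none.
    by_cases hj : ρ j ∈ Q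
    · refine (Finset.card_le_card ?_).trans (card_bundle_distribute_sdiff_le hQ (ρ j))
      exact Finset.sdiff_subset_sdiff subset_rfl (hQsub _ hj i)
    · rw [bundle_distribute_of_notMem hdisj hQ hj]
      exact card_mixedPiece_sdiff_le _ h hsum _ _

end Rounding

/-! ### Counting the codes -/

section Counting

variable {n m : ℕ}

/-- Since `n + 2 * m ≤ 3 * m` and `n! ≥ (n / 3) ^ n`, there are at most `(9 * m / n) ^ n` divisions;
shifts and recipients add a factor `18 ^ n`. The constant `9 * 18 = 162` is below `2 ^ 8 ≤ (m / n) ^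
8`. -/
theorem card_allocationCode_le (hn : 1 ≤ n) (hm : 2 * n ≤ m) :
    (Fintype.card (AllocationCode n m) : ℝ) ≤ ((m : ℝ) / n) ^ (9 * n) := by
  have hn' : (0 : ℝ) < n := by exact_mod_cast hn
  have hm' : (2 : ℝ) * n ≤ m := by exact_mod_cast hm
  have hcard : Fintype.card (AllocationCode n m) =
      (n + 2 * m - 1).choose (2 * m) * (3 ^ n * (3 ^ n * 2 ^ n)) := by
    simp [AllocationCode, Finset.card_finsuppAntidiag_nat_eq_choose]
  have hchoose : (n + 2 * m - 1).choose (2 * m) ≤ (n + 2 * m).choose n := by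
    rw [Nat.choose_symm_of_eq_add (show n + 2 * m = n + 2 * m from rfl)]
    exact Nat.choose_le_choose _ (Nat.sub_le _ _)
  have hbound : ((n + 2 * m).choose n : ℝ) ≤ (9 * ((m : ℝ) / n)) ^ n := by
    have h1 : ((n + 2 * m).choose n : ℝ) ≤ ((n + 2 * m : ℕ) : ℝ) ^ n / n.factorial :=
      Nat.choose_le_pow_div n (n + 2 * m)
    have h2 : (n : ℝ) ^ n / n.factorial ≤ 3 ^ n := by
      calc (n : ℝ) ^ n / n.factorial ≤ Real.exp n := Real.pow_div_factorial_le_exp _ hn'.le n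
        _ = Real.exp 1 ^ n := by rw [← Real.exp_nat_mul, mul_one]
        _ ≤ 3 ^ n := by
          have := Real.exp_one_lt_d9
          gcongr
          linarith
    have h3 : ((n + 2 * m : ℕ) : ℝ) ≤ 3 * (m / n) * n := by
      rw [mul_assoc, div_mul_cancel₀ _ hn'.ne']
      push_cast
      linarith
    calc ((n + 2 * m).choose n : ℝ) ≤ ((n + 2 * m : ℕ) : ℝ) ^ n / n.factorial := h1
      _ ≤ (3 * (m / n) * n) ^ n / n.factorial := by gcongr
      _ = (3 * (m / n)) ^ n * (n ^ n / n.factorial) := by rw [mul_pow, mul_div_assoc]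
      _ ≤ (3 * (m / n)) ^ n * 3 ^ n := by gcongr
      _ = (9 * ((m : ℝ) / n)) ^ n := by rw [← mul_pow]; ring_nf
  have hr : (2 : ℝ) ≤ m / n := by rwa [le_div_iff₀ hn']
  calc (Fintype.card (AllocationCode n m) : ℝ)
      ≤ ((n + 2 * m).choose n : ℝ) * (3 ^ n * (3 ^ n * 2 ^ n)) := by
        rw [hcard]
        push_cast
        gcongr
    _ ≤ (9 * ((m : ℝ) / n)) ^ n * (3 ^ n * (3 ^ n * 2 ^ n)) := by gcongr
    _ = (162 * ((m : ℝ) / n)) ^ n := by rw [← mul_pow, ← mul_pow, ← mul_pow]; ring_nf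
    _ ≤ (((m : ℝ) / n) ^ 9) ^ n := by
        have h4 : (2 : ℝ) ^ 8 ≤ (m / n) ^ 8 := by gcongr
        have h5 : 162 * ((m : ℝ) / n) ≤ (m / n) ^ 8 * (m / n) := by
          gcongr
          linarith
        gcongr
        rwa [pow_succ]
    _ = ((m : ℝ) / n) ^ (9 * n) := by rw [pow_mul]

/-- A family of at most `r ^ k` outputs can be indexed with about `k * logb 2 r` bits. -/
theorem exists_bits {K : Type} [Fintype K] {r : ℝ} {k : ℕ} (hr : 2 ≤ r)
    (hK : (Fintype.card K : ℝ) ≤ r ^ k) (hk : 1 ≤ k) :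
    ∃ b : ℕ, Fintype.card K ≤ 2 ^ b ∧ (b : ℝ) ≤ 2 * (k * Real.logb 2 r) := by
  have hlog : 1 ≤ Real.logb 2 r := by
    rw [Real.le_logb_iff_rpow_le (by norm_num) (by linarith)]
    simpa using hr
  have hk' : (1 : ℝ) ≤ k := by exact_mod_cast hk
  refine ⟨⌈k * Real.logb 2 r⌉₊, ?_, ?_⟩
  · have h1 : (Fintype.card K : ℝ) ≤ 2 ^ (⌈k * Real.logb 2 r⌉₊ : ℝ) := by
      calc (Fintype.card K : ℝ) ≤ r ^ k := hK
        _ = 2 ^ (k * Real.logb 2 r) := by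
          rw [mul_comm, Real.rpow_mul (by norm_num),
            Real.rpow_logb (by norm_num) (by norm_num) (by linarith), Real.rpow_natCast]
        _ ≤ 2 ^ (⌈k * Real.logb 2 r⌉₊ : ℝ) :=
          Real.rpow_le_rpow_of_exponent_le (by norm_num) (Nat.le_ceil _)
    rw [Real.rpow_natCast] at h1
    exact_mod_cast h1
  · have h1 := Nat.ceil_lt_add_one (a := k * Real.logb 2 r) (by positivity)
    nlinarith

end Counting

/-! ### The three complexity bounds -/

theorem monotone_of_mem_additiveValuations {m : ℕ} {v : Valuation m}
    (hv : v ∈ additiveValuations m) : Monotone v := by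
  obtain ⟨w, hw, hadd⟩ := hv
  intro S T hST
  rw [hadd, hadd]
  exact Finset.sum_le_sum_of_subset_of_nonneg hST fun e _ _ => hw e

theorem communicationComplexity_additive_le_logb {n m : ℕ} (hn : 1 ≤ n) (hm : 2 * n ≤ m) :
    (communicationComplexity (instances n (additiveValuations m)) IsEF1 : ENNReal) ≤
      ENNReal.ofReal (2 * (m * Real.logb 2 m)) := by
  refine toENNReal_le_ofReal (communicationComplexity_additive_le hn (by omega)) ?_
  have hm2 : (2 : ℝ) ≤ m := by exact_mod_cast (by omega : 2 ≤ m)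
  have hlog : 1 ≤ Real.logb 2 m := by
    rw [Real.le_logb_iff_rpow_le (by norm_num) (by linarith)]
    simpa using hm2
  have hclog : (Nat.clog 2 m : ℝ) ≤ 2 * Real.logb 2 m := by
    have h1 := Nat.ceil_lt_add_one (a := Real.logb 2 m) (by linarith)
    have h2 := Real.natCeil_logb_natCast 2 m
    push_cast at h2
    rw [← h2]
    linarith
  push_cast
  nlinarith

theorem descriptionComplexity_additive_le_logb {n m : ℕ} (hn : 1 ≤ n) (hm : 2 * n ≤ m) :
    (descriptionComplexity (instances n (additiveValuations m)) IsEF1 : ENNReal) ≤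
      ENNReal.ofReal (20 * (n * Real.logb 2 m)) := by
  classical
  have : NeZero n := ⟨by omega⟩
  have hn' : (1 : ℝ) ≤ n := by exact_mod_cast hn
  have hm' : (2 : ℝ) * n ≤ m := by exact_mod_cast hm
  have hcard : (Fintype.card (AllocationCode n m × Equiv.Perm (Fin n)) : ℝ) ≤
      (m : ℝ) ^ (10 * n) := by
    have h1 := card_allocationCode_le hn hm
    have h2 : ((n.factorial : ℕ) : ℝ) ≤ (m : ℝ) ^ n := by
      have : n.factorial ≤ m ^ n :=
        (Nat.factorial_le_pow n).trans (Nat.pow_le_pow_left (by omega) n)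
      exact_mod_cast this
    have h3 : (m : ℝ) / n ≤ m := div_le_self (by linarith) hn'
    rw [Fintype.card_prod, Fintype.card_perm, Fintype.card_fin]
    push_cast
    calc (Fintype.card (AllocationCode n m) : ℝ) * (n.factorial : ℝ)
        ≤ ((m : ℝ) / n) ^ (9 * n) * (m : ℝ) ^ n := by gcongr
      _ ≤ (m : ℝ) ^ (9 * n) * (m : ℝ) ^ n := by gcongr
      _ = (m : ℝ) ^ (10 * n) := by rw [← pow_add]; ring_nf
  obtain ⟨b, hb, hb'⟩ := exists_bits (by linarith) hcard (by omega)
  have hex : ∀ v : Fin n → Valuation m, ∃ K : AllocationCode n m × Equiv.Perm (Fin n),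
      v ∈ instances n (additiveValuations m) → IsEF1 v fun e => K.2 (K.1.decode e) := by
    intro v
    by_cases hv : v ∈ instances n (additiveValuations m)
    · obtain ⟨K, π, h⟩ := exists_code_isEF1 (by omega) v
        fun i => monotone_of_mem_additiveValuations (hv i)
      exact ⟨⟨K, π⟩, fun _ => h⟩
    -- Outside the class any code may be sent; the zero valuations supply one.
    · obtain ⟨K, π, -⟩ := exists_code_isEF1 (n := n) (m := m) (by omega) (fun _ _ => 0)
        fun _ => monotone_const
      exact ⟨⟨K, π⟩, fun h => absurd h hv⟩
  choose f hf using hex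
  refine toENNReal_le_ofReal (b := b) (communicationComplexity_le_of_family () (fun _ => 0)
    (fun K : AllocationCode n m × Equiv.Perm (Fin n) => fun e => K.2 (K.1.decode e)) f b hb
    fun x hx => hf (x ()) hx) ?_
  push_cast at hb'
  linarith

theorem communicationComplexity_identical_le_logb {n m : ℕ} (hn : 1 ≤ n) (hm : 2 * n ≤ m)
    {C : Set (Valuation m)} (hC : C ⊆ monotoneValuations m) :
    (communicationComplexity (identicalInstances n C) IsEF1 : ENNReal) ≤
      ENNReal.ofReal (18 * (n * Real.logb 2 ((m : ℝ) / n))) := by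
  classical
  have : NeZero n := ⟨by omega⟩
  have hn' : (0 : ℝ) < n := by exact_mod_cast hn
  have hr : (2 : ℝ) ≤ m / n := by
    rw [le_div_iff₀ hn']
    exact_mod_cast hm
  obtain ⟨b, hb, hb'⟩ := exists_bits hr (card_allocationCode_le hn hm) (by omega)
  have hex : ∀ u : Valuation m, ∃ K : AllocationCode n m,
      Monotone u → IsEF1 (fun _ : Fin n => u) K.decode := by
    intro u
    by_cases hu : Monotone u
    -- Agents with the same valuation are interchangeable, so `π` need not be transmitted.
    · obtain ⟨K, π, h⟩ := exists_code_isEF1 (n := n) (by omega) (fun _ => u) fun _ => hu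
      refine ⟨K, fun _ i j hij => ?_⟩
      have hbundle : ∀ i, Allocation.bundle (fun e => π (K.decode e)) (π i) =
          K.decode.bundle i := by
        intro i
        ext e
        simp [Allocation.bundle]
      have h1 := h (π i) (π j) (π.injective.ne hij)
      rwa [hbundle, hbundle] at h1
    · obtain ⟨K, -⟩ := exists_code_isEF1 (n := n) (m := m) (by omega) (fun _ _ => 0)
        fun _ => monotone_const
      exact ⟨K, fun h => absurd h hu⟩
  choose f hf using hex
  refine toENNReal_le_ofReal (b := b) (communicationComplexity_le_of_family (0 : Fin n)
    (fun _ => 0) AllocationCode.decode f b hb ?_) ?_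
  · rintro x ⟨u, hu, hx⟩
    have hx' : x = fun _ => u := funext hx
    rw [hx']
    exact hf u (hC hu).2
  · push_cast at hb'
    linarith

end FairAllocation

theorem proposition6 :
    -- additive valuations: communication complexity `O(m log m)`
    (∃ c : ℝ, 0 < c ∧ ∀ n m : ℕ, 1 ≤ n → 2 * n ≤ m →
      (communicationComplexity (instances n (additiveValuations m)) IsEF1 : ENNReal) ≤
        ENNReal.ofReal (c * (m * Real.logb 2 m))) ∧
    -- additive valuations: description complexity `O(n log m)`
    (∃ c : ℝ, 0 < c ∧ ∀ n m : ℕ, 1 ≤ n → 2 * n ≤ m →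
      (descriptionComplexity (instances n (additiveValuations m)) IsEF1 : ENNReal) ≤
        ENNReal.ofReal (c * (n * Real.logb 2 m))) ∧
    -- identical valuations: communication complexity `O(n log (m / n))`
    (∃ c : ℝ, 0 < c ∧ ∀ n m : ℕ, 1 ≤ n → 2 * n ≤ m →
      ∀ C : Set (Valuation m), C ⊆ monotoneValuations m →
        (communicationComplexity (identicalInstances n C) IsEF1 : ENNReal) ≤
          ENNReal.ofReal (c * (n * Real.logb 2 ((m : ℝ) / n)))) :=
  ⟨⟨2, by norm_num, fun _ _ hn hm => communicationComplexity_additive_le_logb hn hm⟩,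
    ⟨20, by norm_num, fun _ _ hn hm => descriptionComplexity_additive_le_logb hn hm⟩,
    ⟨18, by norm_num, fun _ _ hn hm _ hC => communicationComplexity_identical_le_logb hn hm hC⟩⟩
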